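/- Let $\mathfrak g$ be the real 6-dimensional Lie algebra underlying the complex Heisenberg algebra, i.e. the strictly upper triangular complex $3\times3$ matrices with entries $z_1,z_2$ above the diagonal and $z_3$ in the corner, so that $[(z_1,z_2,z_3),(w_1,w_2,w_3)]=(0,0,z_1w_2-w_1z_2)$. Let $J_0$ be the complex structure on $\mathfrak g$ given by multiplication by $i$. Let $\mathcal C^+$ be the set of real-linear endomorphisms $J$ of $\mathfrak g$ with $J^2=-1$ and $$[JX,JY]=[X,Y]+J[JX,Y]+J[X,JY]\qquad(X,Y\in\mathfrak g)$$ that induce the same orientation of $\mathfrak g$ as $J_0$. Let $d:\mathfrak g^*\to\Lambda^2\mathfrak g^*$ be the map $d\alpha(X,Y)=-\alpha([X,Y])$, and let $\mathbb D=\ker d$. Then $\mathbb D$ is the 4-dimensional space with basis $e^1=\operatorname{Re}z_1$, $e^2=\operatorname{Im}z_1$, $e^3=\operatorname{Re}z_2$, $e^4=\operatorname{Im}z_2$; it is preserved by $\alpha\mapsto\alpha\circ J$ for every $J\in\mathcal C^+$, and we write $\widehat J$ for the resulting almost complex structure on $\mathbb D$. Let $\mathcal C_-\subset\mathcal C^+$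 be the set of those $J$ for which $\widehat J$ induces the negative orientation of $\mathbb D$, i.e. the one opposite to $e^1\wedge e^2\wedge e^3\wedge e^4$. Give $\mathcal C_-$ the topology of a subspace of the finite-dimensional real vector space $\operatorname{End}_{\mathbb R}(\mathfrak g)$. **Theorem.** $\mathcal C_-$ has the homotopy type of a 2-sphere; that is, $\mathcal C_-$ is homotopy equivalent to $S^2$. -/

import Mathlib

noncomputable section

namespace Iwasawa

/-- The real Lie algebra `𝔤` of the complex Heisenberg group. The triple `z = (z 0, z 1, z 2)`
stands for the strictly upper triangular matrix with entries `z₁ = z 0` and `z₂ = z 1` above the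
diagonal and `z₃ = z 2` in the corner, see `toMatrix` and `toMatrix_lie`. -/
def Heis : Type := Fin 3 → ℂ

instance : NormedAddCommGroup Heis := inferInstanceAs (NormedAddCommGroup (Fin 3 → ℂ))

instance : NormedSpace ℝ Heis := inferInstanceAs (NormedSpace ℝ (Fin 3 → ℂ))

/-- The strictly upper triangular matrix that a triple stands for. -/
def toMatrix (z : Heis) : Matrix (Fin 3) (Fin 3) ℂ :=
  !![0, z 0, z 2; 0, 0, z 1; 0, 0, 0]

/-- The bracket of `𝔤`, the commutator of matrices. -/
instance : Bracket Heis Heis where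
  bracket z w := (![0, 0, z 0 * w 1 - w 0 * z 1] : Fin 3 → ℂ)

theorem lie_def (z w : Heis) : ⁅z, w⁆ = (![0, 0, z 0 * w 1 - w 0 * z 1] : Fin 3 → ℂ) := rfl

theorem lie_zero_coord (z w : Heis) : ⁅z, w⁆ 0 = 0 := rfl

theorem lie_one_coord (z w : Heis) : ⁅z, w⁆ 1 = 0 := rfl

theorem lie_two_coord (z w : Heis) : ⁅z, w⁆ 2 = z 0 * w 1 - w 0 * z 1 := rfl

theorem toMatrix_lie (z w : Heis) :
    toMatrix ⁅z, w⁆ = toMatrix z * toMatrix w - toMatrix w * toMatrix z := by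
  ext i j
  fin_cases i <;> fin_cases j <;>
    simp [toMatrix, lie_zero_coord, lie_one_coord, lie_two_coord]

@[simp] theorem add_coord (z w : Heis) (k : Fin 3) : (z + w) k = z k + w k := rfl

@[simp] theorem neg_coord (z : Heis) (k : Fin 3) : (-z) k = -z k := rfl

@[simp] theorem zero_coord (k : Fin 3) : (0 : Heis) k = 0 := rfl

@[simp] theorem smul_coord (t : ℝ) (z : Heis) (k : Fin 3) : (t • z) k = t * z k :=
  Complex.real_smul

theorem heis_ext {z w : Heis} (h0 : z 0 = w 0) (h1 : z 1 = w 1) (h2 : z 2 = w 2) : z = w := by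
  funext k
  fin_cases k
  exacts [h0, h1, h2]

instance : LieRing Heis where
  add_lie x y z := by
    apply heis_ext <;> simp [lie_zero_coord, lie_one_coord, lie_two_coord]; ring
  lie_add x y z := by
    apply heis_ext <;> simp [lie_zero_coord, lie_one_coord, lie_two_coord]; ring
  lie_self x := by
    apply heis_ext <;> simp [lie_zero_coord, lie_one_coord, lie_two_coord]
  leibniz_lie x y z := by
    apply heis_ext <;> simp [lie_zero_coord, lie_one_coord, lie_two_coord]

instance : LieAlgebra ℝ Heis where
  lie_smul t x y := by
    apply heis_ext <;> simp [lie_zero_coord, lie_one_coord, lie_two_coord]; ring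

/-- `J` is an almost complex structure on `𝔤` satisfying the Newlander-Nirenberg condition;
these are the left-invariant complex structures on the real Heisenberg group. -/
def IsComplexStructure (J : Heis →L[ℝ] Heis) : Prop :=
  (∀ X, J (J X) = -X) ∧ ∀ X Y, ⁅J X, J Y⁆ = ⁅X, Y⁆ + J ⁅J X, Y⁆ + J ⁅X, J Y⁆

/-- The exterior derivative `d : 𝔤* → Λ²𝔤*`, `dα(X, Y) = -α([X, Y])`, the two-form `dα` being
regarded as a bilinear form. -/
def extDeriv : Module.Dual ℝ Heis →ₗ[ℝ] (Heis →ₗ[ℝ] Heis →ₗ[ℝ] ℝ) where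
  toFun α := LinearMap.mk₂ ℝ (fun X Y => -α ⁅X, Y⁆)
    (fun X X' Y => by simp [add_lie]; ring) (fun t X Y => by simp)
    (fun X Y Y' => by simp [lie_add]; ring) (fun t X Y => by simp)
  map_add' α β := by ext X Y; simp; ring
  map_smul' t α := by ext X Y; simp

/-- The space `𝔻 = ker d` of closed invariant one-forms. -/
def closedForms : Submodule ℝ (Module.Dual ℝ Heis) := LinearMap.ker extDeriv

theorem mem_closedForms {α : Module.Dual ℝ Heis} :
    α ∈ closedForms ↔ ∀ X Y : Heis, α ⁅X, Y⁆ = 0 := by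
  simp [closedForms, extDeriv, LinearMap.ext_iff]

/-- The central element of `𝔤` with last coordinate `c`. -/
def central (c : ℂ) : Heis := (![0, 0, c] : Fin 3 → ℂ)

theorem central_eq_lie (c : ℂ) {W : Heis} (hW : W 0 ≠ 0 ∨ W 1 ≠ 0) :
    ∃ Y : Heis, ⁅W, Y⁆ = central c := by
  rcases hW with h | h
  · refine ⟨(![0, c / W 0, 0] : Fin 3 → ℂ), heis_ext rfl rfl ?_⟩
    change W 0 * (c / W 0) - 0 * W 1 = c
    field_simp
    simp
  · refine ⟨(![-c / W 1, 0, 0] : Fin 3 → ℂ), heis_ext rfl rfl ?_⟩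
    change W 0 * 0 - (-c / W 1) * W 1 = c
    field_simp
    simp

theorem mem_closedForms' {α : Module.Dual ℝ Heis} :
    α ∈ closedForms ↔ ∀ c : ℂ, α (central c) = 0 := by
  rw [mem_closedForms]
  constructor
  · intro h c
    obtain ⟨Y, hY⟩ := central_eq_lie c (W := (![1, 0, 0] : Fin 3 → ℂ)) (Or.inl one_ne_zero)
    rw [← hY]
    exact h _ _
  · intro h X Y
    exact h (X 0 * Y 1 - Y 0 * X 1)

/-- A complex structure preserves the centre. -/
theorem IsComplexStructure.map_central {J : Heis →L[ℝ] Heis} (hJ : IsComplexStructure J)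
    (c : ℂ) : ∃ c' : ℂ, J (central c) = central c' := by
  by_contra hne
  have hW : J (central c) 0 ≠ 0 ∨ J (central c) 1 ≠ 0 := by
    by_contra! h
    exact hne ⟨J (central c) 2, heis_ext h.1 h.2 rfl⟩
  obtain ⟨Y, hY⟩ := central_eq_lie c hW
  have hc : ∀ Z : Heis, ⁅central c, Z⁆ = 0 := fun Z =>
    heis_ext rfl rfl (by rw [lie_two_coord]; simp [central])
  have h := hJ.2 (central c) Y
  rw [hc, hc, map_zero, hY, zero_add, add_zero] at h
  exact hne ⟨J (central c) 0 * J Y 1 - J Y 0 * J (central c) 1, h.symm⟩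

/-- A complex structure acts on one-forms by `α ↦ α ∘ J`, and it preserves `𝔻`. -/
theorem IsComplexStructure.mapsTo {J : Heis →L[ℝ] Heis} (hJ : IsComplexStructure J) :
    ∀ α ∈ closedForms, (J : Heis →ₗ[ℝ] Heis).dualMap α ∈ closedForms := by
  intro α hα
  rw [mem_closedForms'] at hα ⊢
  intro c
  obtain ⟨c', hc'⟩ := hJ.map_central c
  rw [LinearMap.dualMap_apply, ContinuousLinearMap.coe_coe, hc']
  exact hα c'

/-- The almost complex structure `Ĵ = J|𝔻` on `𝔻` defined by a complex structure `J`. -/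
def hat {J : Heis →L[ℝ] Heis} (hJ : IsComplexStructure J) : Module.End ℝ closedForms :=
  LinearMap.restrict (J : Heis →ₗ[ℝ] Heis).dualMap hJ.mapsTo

/-- The almost complex structure `A` on `V` induces the orientation `o` of `V`: there is a real
basis `f₁, A f₁, …, fₙ, A fₙ` with orientation `o`. -/
def InducesOrientation {V : Type*} [AddCommGroup V] [Module ℝ V] {n : ℕ} (A : Module.End ℝ V)
    (o : Orientation ℝ V (Fin n × Fin 2)) : Prop :=
  ∃ f : Module.Basis (Fin n × Fin 2) ℝ V,
    (∀ k, f (k, 1) = A (f (k, 0))) ∧ f.orientation = o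

/-- The real coordinates on `𝔤`: real and imaginary parts of `z₁, z₂, z₃`. -/
def coord (p : Fin 3 × Fin 2) : Module.Dual ℝ Heis where
  toFun z := ![(z p.1).re, (z p.1).im] p.2
  map_add' z w := by
    obtain ⟨k, j⟩ := p
    fin_cases j <;> simp
  map_smul' t z := by
    obtain ⟨k, j⟩ := p
    fin_cases j <;> simp

/-- The real basis `E₁, i E₁, E₂, i E₂, E₃, i E₃` of `𝔤`, where `E₁, E₂, E₃` is its standard
complex basis. -/
def stdBasis : Module.Basis (Fin 3 × Fin 2) ℝ Heis :=
  Module.Basis.ofEquivFun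
    { toFun := fun z p => coord p z
      map_add' := fun z w => by funext p; simp
      map_smul' := fun t z => by funext p; simp
      invFun := fun c => (fun k => ⟨c (k, 0), c (k, 1)⟩ : Fin 3 → ℂ)
      left_inv := fun z => rfl
      right_inv := fun c => by
        funext p
        obtain ⟨k, j⟩ := p
        fin_cases j <;> rfl }

theorem coord_stdBasis (p q : Fin 3 × Fin 2) : coord p (stdBasis q) = if p = q then 1 else 0 := by
  have h : coord p (stdBasis q) = stdBasis.repr (stdBasis q) p := rfl
  rw [h, stdBasis.repr_self, Finsupp.single_apply]
  simp only [eq_comm]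

theorem stdBasis_two (j : Fin 2) : ∃ c : ℂ, stdBasis (2, j) = central c := by
  refine ⟨stdBasis (2, j) 2, heis_ext ?_ ?_ rfl⟩
  · exact Complex.ext (by simpa [coord, central] using coord_stdBasis (0, 0) (2, j))
      (by simpa [coord, central] using coord_stdBasis (0, 1) (2, j))
  · exact Complex.ext (by simpa [coord, central] using coord_stdBasis (1, 0) (2, j))
      (by simpa [coord, central] using coord_stdBasis (1, 1) (2, j))

/-- The bi-invariant complex structure `J₀` of the complex Heisenberg group, multiplication by `i`. -/
def J₀ : Heis →L[ℝ] Heis :=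
  (Complex.I • ContinuousLinearMap.id ℝ (Fin 3 → ℂ) : (Fin 3 → ℂ) →L[ℝ] (Fin 3 → ℂ))

theorem J₀_orientation : InducesOrientation (J₀ : Heis →ₗ[ℝ] Heis) stdBasis.orientation := by
  refine ⟨stdBasis, fun k => ?_, rfl⟩
  rw [stdBasis, Module.Basis.coe_ofEquivFun]
  funext l
  change (⟨_, _⟩ : ℂ) = Complex.I * (⟨_, _⟩ : ℂ)
  apply Complex.ext <;> by_cases h : l = k <;> simp [h]

theorem coord_mem (k : Fin 2) (j : Fin 2) : coord (k.castSucc, j) ∈ closedForms := by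
  rw [mem_closedForms']
  intro c
  fin_cases k <;> fin_cases j <;> simp [coord, central]

/-- The basis `e¹ = Re z₁, e² = Im z₁, e³ = Re z₂, e⁴ = Im z₂` of `𝔻`. -/
def formBasis : Module.Basis (Fin 2 × Fin 2) ℝ closedForms :=
  Module.Basis.ofEquivFun
    { toFun := fun α p => (α : Module.Dual ℝ Heis) (stdBasis (p.1.castSucc, p.2))
      map_add' := fun α β => by funext p; simp
      map_smul' := fun t α => by funext p; simp
      invFun := fun c => ∑ p, c p • ⟨coord (p.1.castSucc, p.2), coord_mem p.1 p.2⟩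
      left_inv := fun α => by
        apply Subtype.ext
        refine stdBasis.ext fun q => ?_
        have h2 : ∀ j, (α : Module.Dual ℝ Heis) (stdBasis (2, j)) = 0 := fun j => by
          obtain ⟨c, hc⟩ := stdBasis_two j
          rw [hc]
          exact mem_closedForms'.1 α.2 _
        obtain ⟨k, j⟩ := q
        fin_cases k <;> fin_cases j <;>
          simp [Fintype.sum_prod_type, coord_stdBasis, h2]
      right_inv := fun c => by
        funext p
        obtain ⟨k, j⟩ := p
        fin_cases k <;> fin_cases j <;> simp [Fintype.sum_prod_type, coord_stdBasis] }

theorem formBasis_apply (p : Fin 2 × Fin 2) :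
    (formBasis p : Module.Dual ℝ Heis) = coord (p.1.castSucc, p.2) := by
  rw [formBasis, Module.Basis.coe_ofEquivFun]
  simp [Pi.single_apply]

/-- The orientation of `𝔻` defined by `e¹, e², e³, e⁴`. -/
def formOrientation : Orientation ℝ closedForms (Fin 2 × Fin 2) :=
  Module.Basis.orientation (R := ℝ) (M := closedForms) formBasis

/-- The set `𝒞⁺` of complex structures on `𝔤` inducing the same orientation as `J₀`, with the
topology of the space of linear endomorphisms of `𝔤`. -/
def CPlus : Set (Heis →L[ℝ] Heis) :=
  {J | IsComplexStructure J ∧ InducesOrientation (J : Heis →ₗ[ℝ] Heis) stdBasis.orientation}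

/-- The set `𝒞₋` of those `J ∈ 𝒞⁺` for which `Ĵ` induces on `𝔻` the negative orientation, that
is, the one opposite to that of `e¹, e², e³, e⁴`. -/
def CMinus : Set (Heis →L[ℝ] Heis) :=
  {J | J ∈ CPlus ∧
    ∃ hJ : IsComplexStructure J, InducesOrientation (V := closedForms) (hat hJ) (-formOrientation)}

end Iwasawa

end

/-!
Real coordinates split `Heis` as `ℝ⁴ × ℝ²`, the second factor being the centre. A complex structure
preserves the centre, so it is a triple of blocks `(A, B, j)` with `A² = -1`, `j² = -1` and
`B A + j B = 0`; integrability is a condition on the pair `(A, j)` only. The two orientation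
conditions say that both `A` and `j` are negative. For `A` this is the sign of the Pfaffian of
`A - Aᵀ`: in a basis `v, A v, w, A w` that Pfaffian is positive by the Bessel inequality for the
`A`-invariant metric `⟪X, Y⟫ + ⟪A X, A Y⟫` (`det_mul_pfaff_pos`). Since any two bases `f, A f` have the
same orientation, as a complex linear map has positive real determinant, `CMinus` is homeomorphic
to the set `model` of triples satisfying these conditions (`homeomorphModel`).

Two homotopies contract `model` onto a sphere. The skew part of `A` is the sum of a self-dual and an
anti-self-dual matrix, that is, of a left and a right multiplication by imaginary quaternions. If `A`
is negative, the anti-self-dual part is the larger one, and normalising it gives an orthogonal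
complex structure `Q`, a point of the two-sphere. The matrix `1 - A Q` intertwines `A` with `Q`. It
is the sum `E + O` of a part commuting with `Q` and a part anticommuting with `Q`, and `E + t O` is
invertible for `t² ≤ 1`. Hence `A_t = (E + t O) Q (E + t O)⁻¹` is a path of complex structures
from `Q` to `A`. The bracket is a self-dual two-form with values in the centre, so it is
`Q`-invariant, and for this reason the integrability defect of `(A_t, j)`, pulled back by `E + t O`,
is `t` times a form that does not depend on `t` (`integrability_defect`). So `j` may be kept fixed
along the path. As `(Q, j)` is integrable for all `j`, the second homotopy moves `j` to `-i` in the
contractible space of negative complex structures of the plane.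
-/

noncomputable section

namespace Iwasawa

open Matrix

/-! ### Orientations induced by complex structures -/

section ComplexModule

variable {V : Type*} [AddCommGroup V] [Module ℝ V]

/-- The complex vector space structure on `V` for which `A` is multiplication by `i`. -/
abbrev complexModule (A : Module.End ℝ V) (hA : A * A = -1) : Module ℂ V :=
  Module.compHom V (Complex.lift ⟨A, hA⟩ : ℂ →ₐ[ℝ] Module.End ℝ V).toRingHom

theorem complexModule_smul (A : Module.End ℝ V) (hA : A * A = -1) (z : ℂ) (v : V) :
    (letI := complexModule A hA; z • v) = z.re • v + z.im • A v := by
  change (Complex.lift ⟨A, hA⟩ : ℂ →ₐ[ℝ] Module.End ℝ V) z v = _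
  simp [Complex.liftAux_apply, Module.algebraMap_end_apply]

theorem complexModule_isScalarTower (A : Module.End ℝ V) (hA : A * A = -1) :
    letI := complexModule A hA; IsScalarTower ℝ ℂ V := by
  let := complexModule A hA
  refine ⟨fun t z v => ?_⟩
  rw [complexModule_smul A hA, complexModule_smul A hA]
  simp [mul_smul, smul_add]

/-- The real determinant of a complex linear automorphism is the squared modulus of its complex
determinant. -/
theorem det_pos_of_commute [FiniteDimensional ℝ V] (A : Module.End ℝ V) (hA : A * A = -1)
    (T : V ≃ₗ[ℝ] V) (hT : ∀ v, T (A v) = A (T v)) : 0 < LinearMap.det (T : V →ₗ[ℝ] V) := by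
  let := complexModule A hA
  have := complexModule_isScalarTower A hA
  let T' : V →ₗ[ℂ] V :=
    { toFun := T
      map_add' := map_add T
      map_smul' := fun z v => by
        rw [complexModule_smul A hA, RingHom.id_apply, complexModule_smul A hA]
        simp [hT] }
  have h : (T : V →ₗ[ℝ] V) = T'.restrictScalars ℝ := rfl
  have h0 : LinearMap.det (T : V →ₗ[ℝ] V) ≠ 0 := (LinearEquiv.isUnit_det' T).ne_zero
  rw [h, LinearMap.det_restrictScalars, Algebra.norm_complex_apply] at h0 ⊢
  exact (Complex.normSq_nonneg _).lt_of_ne' h0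

/-- All bases of the form `f₁, A f₁, …, fₙ, A fₙ` have the same orientation. -/
theorem orientation_eq_of_adapted {n : ℕ} (A : Module.End ℝ V) (hA : A * A = -1)
    (f g : Module.Basis (Fin n × Fin 2) ℝ V) (hf : ∀ k, f (k, 1) = A (f (k, 0)))
    (hg : ∀ k, g (k, 1) = A (g (k, 0))) : f.orientation = g.orientation := by
  have := Module.Basis.finiteDimensional_of_finite f
  rw [Module.Basis.orientation_eq_iff_det_pos]
  have hA' : ∀ v, A (A v) = -v := fun v => LinearMap.congr_fun hA v
  let T : V ≃ₗ[ℝ] V := f.equiv g (Equiv.refl _)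
  have hTf : ∀ p, T (f p) = g p := fun p => by simp [T]
  have hT : ∀ v, T (A v) = A (T v) := by
    refine LinearMap.congr_fun (f := (T : V →ₗ[ℝ] V) ∘ₗ A) (g := A ∘ₗ (T : V →ₗ[ℝ] V))
      (f.ext fun ⟨k, j⟩ => ?_)
    fin_cases j
    · simp [hTf, ← hf, ← hg]
    · simp only [Fin.mk_one, LinearMap.comp_apply, LinearEquiv.coe_coe]
      rw [hf, hA', map_neg, hTf, ← hf, hTf, hg, hA']
  have h : f.det g = LinearMap.det (T : V →ₗ[ℝ] V) := by
    rw [← mul_one (LinearMap.det _), ← f.det_self, ← f.det_comp]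
    congr 1
    funext p
    simp [hTf]
  rw [h]
  exact det_pos_of_commute A hA T hT

/-- A complex basis `f₁, …, fₙ` gives the real basis `f₁, A f₁, …, fₙ, A fₙ`. -/
theorem exists_adapted [FiniteDimensional ℝ V] {n : ℕ} (A : Module.End ℝ V) (hA : A * A = -1)
    (hn : Module.finrank ℝ V = n * 2) :
    ∃ f : Module.Basis (Fin n × Fin 2) ℝ V, ∀ k, f (k, 1) = A (f (k, 0)) := by
  let := complexModule A hA
  have := complexModule_isScalarTower A hA
  have : Module.Finite ℂ V := Module.Finite.of_restrictScalars_finite ℝ ℂ V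
  have hd : Module.finrank ℂ V = n := by
    have := Module.finrank_mul_finrank ℝ ℂ V
    rw [Complex.finrank_real_complex] at this
    omega
  let b := Module.finBasisOfFinrankEq ℂ V hd
  refine ⟨(Complex.basisOneI.smulTower b).reindex (Equiv.prodComm _ _), fun k => ?_⟩
  simp only [Module.Basis.reindex_apply, Equiv.prodComm_symm, Equiv.prodComm_apply, Prod.swap,
    Module.Basis.smulTower_apply]
  rw [complexModule_smul A hA, complexModule_smul A hA]
  simp

theorem inducesOrientation_iff {n : ℕ} (A : Module.End ℝ V) (hA : A * A = -1)
    (f : Module.Basis (Fin n × Fin 2) ℝ V) (hf : ∀ k, f (k, 1) = A (f (k, 0)))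
    (o : Orientation ℝ V (Fin n × Fin 2)) : InducesOrientation A o ↔ f.orientation = o :=
  ⟨fun ⟨g, hg, ho⟩ => ho ▸ orientation_eq_of_adapted A hA f g hf hg, fun h => ⟨f, hf, h⟩⟩

theorem inducesOrientation_iff_det_pos {n : ℕ} (A : Module.End ℝ V) (hA : A * A = -1)
    (b f : Module.Basis (Fin n × Fin 2) ℝ V) (hf : ∀ k, f (k, 1) = A (f (k, 0))) :
    InducesOrientation A b.orientation ↔ 0 < b.det f := by
  rw [inducesOrientation_iff A hA f hf, eq_comm, Module.Basis.orientation_eq_iff_det_pos]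

theorem inducesOrientation_neg_iff_det_neg {n : ℕ} (A : Module.End ℝ V) (hA : A * A = -1)
    (b f : Module.Basis (Fin n × Fin 2) ℝ V) (hf : ∀ k, f (k, 1) = A (f (k, 0))) :
    InducesOrientation A (-b.orientation) ↔ b.det f < 0 := by
  have h0 : b.det f ≠ 0 := (b.isUnit_det f).ne_zero
  rw [inducesOrientation_iff A hA f hf, ← Module.Basis.orientation_ne_iff_eq_neg, ne_comm, ne_eq,
    Module.Basis.orientation_eq_iff_det_pos, not_lt, le_iff_lt_or_eq, or_iff_left h0]

end ComplexModule

/-! ### The Pfaffian as an orientation test in dimension four -/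

/-- The Pfaffian of the skew-symmetric matrix `A - Aᵀ`. -/
def pfaff (A : Matrix (Fin 4) (Fin 4) ℝ) : ℝ :=
  (A 0 1 - A 1 0) * (A 2 3 - A 3 2) - (A 0 2 - A 2 0) * (A 1 3 - A 3 1) +
    (A 0 3 - A 3 0) * (A 1 2 - A 2 1)

theorem pfaff_transpose (A : Matrix (Fin 4) (Fin 4) ℝ) : pfaff Aᵀ = pfaff A := by
  simp only [pfaff, transpose_apply]; ring

/-- Laplace expansion along the first two columns. -/
theorem det_fin_four (F : Matrix (Fin 4) (Fin 4) ℝ) : F.det =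
    (F 0 0 * F 1 1 - F 0 1 * F 1 0) * (F 2 2 * F 3 3 - F 2 3 * F 3 2)
    - (F 0 0 * F 2 1 - F 0 1 * F 2 0) * (F 1 2 * F 3 3 - F 1 3 * F 3 2)
    + (F 0 0 * F 3 1 - F 0 1 * F 3 0) * (F 1 2 * F 2 3 - F 1 3 * F 2 2)
    + (F 1 0 * F 2 1 - F 1 1 * F 2 0) * (F 0 2 * F 3 3 - F 0 3 * F 3 2)
    - (F 1 0 * F 3 1 - F 1 1 * F 3 0) * (F 0 2 * F 2 3 - F 0 3 * F 2 2)
    + (F 2 0 * F 3 1 - F 2 1 * F 3 0) * (F 0 2 * F 1 3 - F 0 3 * F 1 2) := by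
  simp [Matrix.det_succ_row_zero, Fin.sum_univ_succ, Fin.succAbove, Matrix.submatrix_apply]
  ring

theorem pfaff_congr (A F : Matrix (Fin 4) (Fin 4) ℝ) :
    pfaff (Fᵀ * A * F) = F.det * pfaff A := by
  rw [det_fin_four]
  simp only [pfaff, Matrix.mul_apply, Fin.sum_univ_four, transpose_apply]
  ring

/-- If the columns of `F` are `x, A x, z, A z`, then `det F` and the Pfaffian have the same sign. The
metric `h(X, Y) = ⟪X, Y⟫ + ⟪A X, A Y⟫` is `A`-invariant with `h(A X, Y)` represented by `Aᵀ - A`, so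
their product is `h(x, x) h(z, z) - h(x, z)² - h(A x, z)²`, positive by the Bessel inequality. -/
theorem det_mul_pfaff_pos {A F : Matrix (Fin 4) (Fin 4) ℝ} (hA : A * A = -1) (hF : F.det ≠ 0)
    (h1 : F.col 1 = A *ᵥ F.col 0) (h3 : F.col 3 = A *ᵥ F.col 2) : 0 < F.det * pfaff A := by
  have h1' : A *ᵥ F.col 1 = -F.col 0 := by rw [h1, mulVec_mulVec, hA, neg_mulVec, one_mulVec]
  have h3' : A *ᵥ F.col 3 = -F.col 2 := by rw [h3, mulVec_mulVec, hA, neg_mulVec, one_mulVec]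
  obtain ⟨x, hx⟩ : ∃ x, F.col 0 = x := ⟨_, rfl⟩
  obtain ⟨y, hy⟩ : ∃ y, F.col 1 = y := ⟨_, rfl⟩
  obtain ⟨z, hz⟩ : ∃ z, F.col 2 = z := ⟨_, rfl⟩
  obtain ⟨w, hw⟩ : ∃ w, F.col 3 = w := ⟨_, rfl⟩
  rw [hx, hy] at h1 h1'
  rw [hz, hw] at h3 h3'
  have hE : ∀ i k, (Fᵀ * A * F) i k = F.col i ⬝ᵥ (A *ᵥ F.col k) := fun i k => by
    rw [Matrix.mul_assoc]; rfl
  have hpf : F.det * pfaff A = (x ⬝ᵥ x + y ⬝ᵥ y) * (z ⬝ᵥ z + w ⬝ᵥ w) -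
      (x ⬝ᵥ z + y ⬝ᵥ w) ^ 2 - (y ⬝ᵥ z - x ⬝ᵥ w) ^ 2 := by
    rw [← pfaff_congr]
    simp only [pfaff, hE, hx, hy, hz, hw, ← h1, h1', ← h3, h3', dotProduct_neg]
    rw [dotProduct_comm z y, dotProduct_comm z x, dotProduct_comm w x, dotProduct_comm w y]
    ring
  set a := x ⬝ᵥ x + y ⬝ᵥ y
  set s := x ⬝ᵥ z + y ⬝ᵥ w
  set r := y ⬝ᵥ z - x ⬝ᵥ w
  have hFv : ∀ c : Fin 4 → ℝ, F *ᵥ c = c 0 • x + c 1 • y + c 2 • z + c 3 • w := fun c => by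
    ext i
    simp only [mulVec, dotProduct, Fin.sum_univ_four, ← hx, ← hy, ← hz, ← hw, Pi.add_apply,
      Pi.smul_apply, smul_eq_mul, col_apply]
    ring
  have hinj : ∀ c : Fin 4 → ℝ, F *ᵥ c = 0 → c = 0 := fun c hc =>
    eq_zero_of_mulVec_eq_zero hF hc
  have hx0 : x ≠ 0 := fun h => by
    have := congr_fun (hinj ![1, 0, 0, 0] (by simp [hFv, h])) 0
    simp at this
  have hsq : ∀ v : Fin 4 → ℝ, 0 ≤ v ⬝ᵥ v := fun v =>
    Finset.sum_nonneg fun i _ => mul_self_nonneg (v i)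
  have hpos : ∀ v : Fin 4 → ℝ, v ≠ 0 → 0 < v ⬝ᵥ v := fun v hv =>
    (hsq v).lt_of_ne' fun h => hv (dotProduct_self_eq_zero.1 h)
  have ha : 0 < a := add_pos_of_pos_of_nonneg (hpos x hx0) (hsq y)
  -- The component of `z` that is `h`-orthogonal to `x` and `A x`, multiplied by `a = h(x, x)`.
  have hu : a • z - s • x - r • y ≠ 0 := fun h => by
    have := congr_fun (hinj ![-s, -r, a, 0] (by rw [hFv, ← h]; simp; abel)) 2
    exact ha.ne' (by simpa using this)
  have key : (a • z - s • x - r • y) ⬝ᵥ (a • z - s • x - r • y) +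
      (a • w - s • y + r • x) ⬝ᵥ (a • w - s • y + r • x) = a * (F.det * pfaff A) := by
    rw [hpf]
    simp only [a, s, r, dotProduct, Fin.sum_univ_four, Pi.add_apply, Pi.sub_apply, Pi.smul_apply,
      smul_eq_mul]
    ring
  have := add_pos_of_pos_of_nonneg (hpos _ hu) (hsq (a • w - s • y + r • x))
  rw [key] at this
  exact pos_of_mul_pos_right this ha.le

/-! ### Self-dual and anti-self-dual matrices -/

/-- The self-dual skew-symmetric matrix with coordinates `p`; these matrices are the multiplications
by imaginary quaternions from one side, and those of `rquat` from the other side. -/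
def lquat (p : Fin 3 → ℝ) : Matrix (Fin 4) (Fin 4) ℝ :=
  !![0, p 0, p 1, p 2; -p 0, 0, p 2, -p 1; -p 1, -p 2, 0, p 0; -p 2, p 1, -p 0, 0]

/-- The anti-self-dual skew-symmetric matrix with coordinates `q`. -/
def rquat (q : Fin 3 → ℝ) : Matrix (Fin 4) (Fin 4) ℝ :=
  !![0, q 0, q 1, q 2; -q 0, 0, -q 2, q 1; -q 1, q 2, 0, -q 0; -q 2, -q 1, q 0, 0]

theorem rquat_mul_self (q : Fin 3 → ℝ) : rquat q * rquat q = -(q ⬝ᵥ q) • 1 := by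
  ext i k
  fin_cases i <;> fin_cases k <;>
    simp [rquat, Matrix.mul_apply, Fin.sum_univ_four, dotProduct, Fin.sum_univ_three] <;> ring

theorem lquat_mul_self (q : Fin 3 → ℝ) : lquat q * lquat q = -(q ⬝ᵥ q) • 1 := by
  ext i k
  fin_cases i <;> fin_cases k <;>
    simp [lquat, Matrix.mul_apply, Fin.sum_univ_four, dotProduct, Fin.sum_univ_three] <;> ring

theorem lquat_mul_rquat (p q : Fin 3 → ℝ) : lquat p * rquat q = rquat q * lquat p := by
  ext i k
  fin_cases i <;> fin_cases k <;>
    simp [lquat, rquat, Matrix.mul_apply, Fin.sum_univ_four] <;> ring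

theorem rquat_smul (t : ℝ) (q : Fin 3 → ℝ) : rquat (t • q) = t • rquat q := by
  ext i k
  fin_cases i <;> fin_cases k <;> simp [rquat]

theorem pfaff_rquat (q : Fin 3 → ℝ) : pfaff (rquat q) = -4 * (q ⬝ᵥ q) := by
  simp [pfaff, rquat, dotProduct, Fin.sum_univ_three]; ring

/-- The skew-symmetric part of a matrix. -/
def skewPart (A : Matrix (Fin 4) (Fin 4) ℝ) : Matrix (Fin 4) (Fin 4) ℝ := (2⁻¹ : ℝ) • (A - Aᵀ)

/-- The symmetric part of a matrix. -/
def symPart (A : Matrix (Fin 4) (Fin 4) ℝ) : Matrix (Fin 4) (Fin 4) ℝ := (2⁻¹ : ℝ) • (A + Aᵀ)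

/-- The coordinates of the self-dual part of `skewPart A`. -/
def lvec (A : Matrix (Fin 4) (Fin 4) ℝ) : Fin 3 → ℝ :=
  ![(A 0 1 - A 1 0 + (A 2 3 - A 3 2)) / 4, (A 0 2 - A 2 0 - (A 1 3 - A 3 1)) / 4,
    (A 0 3 - A 3 0 + (A 1 2 - A 2 1)) / 4]

/-- The coordinates of the anti-self-dual part of `skewPart A`. -/
def rvec (A : Matrix (Fin 4) (Fin 4) ℝ) : Fin 3 → ℝ :=
  ![(A 0 1 - A 1 0 - (A 2 3 - A 3 2)) / 4, (A 0 2 - A 2 0 + (A 1 3 - A 3 1)) / 4,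
    (A 0 3 - A 3 0 - (A 1 2 - A 2 1)) / 4]

theorem rvec_rquat (q : Fin 3 → ℝ) : rvec (rquat q) = q := by
  ext i
  fin_cases i <;> simp [rvec, rquat] <;> ring

theorem skewPart_eq (A : Matrix (Fin 4) (Fin 4) ℝ) :
    skewPart A = lquat (lvec A) + rquat (rvec A) := by
  ext i k
  fin_cases i <;> fin_cases k <;> simp [skewPart, lquat, rquat, lvec, rvec] <;> ring

theorem pfaff_eq (A : Matrix (Fin 4) (Fin 4) ℝ) :
    pfaff A = 4 * (lvec A ⬝ᵥ lvec A - rvec A ⬝ᵥ rvec A) := by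
  simp [pfaff, lvec, rvec, dotProduct, Fin.sum_univ_three]; ring

theorem skewPart_add_symPart (A : Matrix (Fin 4) (Fin 4) ℝ) : skewPart A + symPart A = A := by
  rw [skewPart, symPart, ← smul_add, show A - Aᵀ + (A + Aᵀ) = (2 : ℝ) • A by module, smul_smul]
  norm_num

theorem transpose_mul_self {A : Matrix (Fin 4) (Fin 4) ℝ} (hA : A * A = -1) : Aᵀ * Aᵀ = -1 := by
  rw [← transpose_mul, hA, transpose_neg, transpose_one]

theorem skewPart_symPart_anticomm {A : Matrix (Fin 4) (Fin 4) ℝ} (hA : A * A = -1) :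
    skewPart A * symPart A + symPart A * skewPart A = 0 := by
  have h := transpose_mul_self hA
  simp only [skewPart, symPart, smul_mul_smul_comm, ← smul_add]
  rw [show (A - Aᵀ) * (A + Aᵀ) + (A + Aᵀ) * (A - Aᵀ) = (2 : ℤ) • (A * A - Aᵀ * Aᵀ) by noncomm_ring,
    hA, h]
  simp

theorem skewPart_sq_add_symPart_sq {A : Matrix (Fin 4) (Fin 4) ℝ} (hA : A * A = -1) :
    skewPart A * skewPart A + symPart A * symPart A = -1 := by
  have h := transpose_mul_self hA
  simp only [skewPart, symPart, smul_mul_smul_comm, ← smul_add]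
  rw [show (A - Aᵀ) * (A - Aᵀ) + (A + Aᵀ) * (A + Aᵀ) = (2 : ℤ) • (A * A + Aᵀ * Aᵀ) by noncomm_ring,
    hA, h, show (2 : ℤ) • (-1 + -1 : Matrix (Fin 4) (Fin 4) ℝ) = (4 : ℝ) • (-1) by module, smul_smul]
  norm_num

/-- The squares of the skew part `K` and the symmetric part `S` satisfy `K² = -1 - S²`, and this is
negative definite. -/
theorem isUnit_skewPart {A : Matrix (Fin 4) (Fin 4) ℝ} (hA : A * A = -1) :
    IsUnit (skewPart A) := by
  rw [Matrix.isUnit_iff_isUnit_det, isUnit_iff_ne_zero]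
  intro h0
  obtain ⟨v, hv, hv0⟩ := Matrix.exists_mulVec_eq_zero_iff.2 h0
  have hS : (symPart A)ᵀ = symPart A := by simp [symPart, add_comm]
  have h := congrArg (fun M => v ⬝ᵥ (M *ᵥ v)) (skewPart_sq_add_symPart_sq hA)
  simp only [add_mulVec, ← mulVec_mulVec, hv0, mulVec_zero, zero_add, neg_mulVec, one_mulVec,
    dotProduct_neg] at h
  rw [dotProduct_mulVec, ← mulVec_transpose, hS] at h
  have h1 : 0 ≤ symPart A *ᵥ v ⬝ᵥ symPart A *ᵥ v :=
    Finset.sum_nonneg fun i _ => mul_self_nonneg _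
  have h2 : 0 ≤ v ⬝ᵥ v := Finset.sum_nonneg fun i _ => mul_self_nonneg _
  exact hv (dotProduct_self_eq_zero.1 (by linarith))

theorem pfaff_ne_zero {A : Matrix (Fin 4) (Fin 4) ℝ} (hA : A * A = -1) : pfaff A ≠ 0 := by
  have h : (skewPart A).det = (pfaff A / 4) ^ 2 := by
    rw [det_fin_four]
    simp only [skewPart, pfaff, Matrix.smul_apply, Matrix.sub_apply, transpose_apply, smul_eq_mul]
    ring
  have h0 := (Matrix.isUnit_iff_isUnit_det _).1 (isUnit_skewPart hA)
  rw [h, isUnit_iff_ne_zero] at h0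
  intro h1
  simp [h1] at h0

/-- Conjugation by the invertible skew part changes the sign of the symmetric part. -/
theorem trace_eq_zero {A : Matrix (Fin 4) (Fin 4) ℝ} (hA : A * A = -1) : A.trace = 0 := by
  have hK := isUnit_skewPart hA
  have htr : (symPart A).trace = A.trace := by
    simp [symPart, trace_smul, trace_add, trace_transpose]; ring
  obtain ⟨u, hu⟩ := hK
  have h : symPart A = -((u : Matrix (Fin 4) (Fin 4) ℝ) * symPart A * (↑u⁻¹ : Matrix _ _ ℝ)) := by
    rw [hu, eq_neg_of_add_eq_zero_left (skewPart_symPart_anticomm hA), ← hu, neg_mul, neg_neg,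
      Matrix.mul_assoc, Units.mul_inv, Matrix.mul_one]
  have h2 := congrArg trace h
  rw [trace_neg, trace_units_conj, htr] at h2
  linarith

/-- The anticommutator of a trace-free symmetric matrix with an anti-self-dual matrix is self-dual,
and that with a self-dual matrix is anti-self-dual. As the two add up to the anticommutator with
`skewPart A`, which is zero, each of them vanishes. -/
theorem symPart_rquat_anticomm {A : Matrix (Fin 4) (Fin 4) ℝ} (hA : A * A = -1) :
    symPart A * rquat (rvec A) = -(rquat (rvec A) * symPart A) := by
  have h := skewPart_symPart_anticomm hA
  have ht := trace_eq_zero hA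
  simp only [trace, diag_apply, Fin.sum_univ_four] at ht
  have hs : ∀ i k, symPart A i k = symPart A k i := fun i k => by simp [symPart, add_comm]
  have ht' : symPart A 0 0 + symPart A 1 1 + symPart A 2 2 + symPart A 3 3 = 0 := by
    simp [symPart]; linarith
  rw [skewPart_eq] at h
  generalize symPart A = S at *
  generalize rvec A = q at *
  generalize lvec A = p at *
  rw [← add_eq_zero_iff_eq_neg]
  have e : ∀ i k, _ := fun i k => congrFun (congrFun h i) k
  have e01 := e 0 1
  have e02 := e 0 2
  have e03 := e 0 3
  have e12 := e 1 2
  have e13 := e 1 3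
  have e23 := e 2 3
  clear e h ht
  simp only [Matrix.add_apply, Matrix.mul_apply, Fin.sum_univ_four, Matrix.zero_apply, hs 1 0,
    hs 2 0, hs 2 1, hs 3 1, hs 3 2] at e01 e02 e03 e12 e13 e23
  simp [lquat, rquat] at e01 e02 e03 e12 e13 e23
  ext i k
  simp only [Matrix.add_apply, Matrix.mul_apply, Fin.sum_univ_four, Matrix.zero_apply]
  fin_cases i <;> fin_cases k <;>
    simp [rquat, hs 1 0, hs 2 0, hs 3 0, hs 2 1, hs 3 1, hs 3 2]
  · ring
  · linear_combination (e01 + e23) / 2 + (q 0 - p 0) / 2 * ht'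
  · linear_combination (e02 - e13) / 2 + (q 1 - p 1) / 2 * ht'
  · linear_combination (e03 + e12) / 2 + (q 2 - p 2) / 2 * ht'
  · linear_combination -((e01 + e23) / 2 + (q 0 - p 0) / 2 * ht')
  · ring
  · linear_combination (e03 + e12) / 2 - (q 2 + p 2) / 2 * ht'
  · linear_combination (e13 - e02) / 2 + (q 1 + p 1) / 2 * ht'
  · linear_combination -((e02 - e13) / 2 + (q 1 - p 1) / 2 * ht')
  · linear_combination -((e03 + e12) / 2 - (q 2 + p 2) / 2 * ht')
  · ring
  · linear_combination (e01 + e23) / 2 - (q 0 + p 0) / 2 * ht'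
  · linear_combination -((e03 + e12) / 2 + (q 2 - p 2) / 2 * ht')
  · linear_combination -((e13 - e02) / 2 + (q 1 + p 1) / 2 * ht')
  · linear_combination -((e01 + e23) / 2 - (q 0 + p 0) / 2 * ht')
  · ring

/-! ### The deformation onto an orthogonal complex structure -/

/-- The unit vector in the direction of `rvec A`; it is zero if `rvec A` is. -/
def unitRvec (A : Matrix (Fin 4) (Fin 4) ℝ) : Fin 3 → ℝ := (√(rvec A ⬝ᵥ rvec A))⁻¹ • rvec A

/-- The orthogonal complex structure defined by the normalised anti-self-dual part of `A`. -/
def orthPart (A : Matrix (Fin 4) (Fin 4) ℝ) : Matrix (Fin 4) (Fin 4) ℝ := rquat (unitRvec A)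

/-- For negative `A` the anti-self-dual part of `A` is longer than the self-dual part. -/
theorem lvec_lt_rvec {A : Matrix (Fin 4) (Fin 4) ℝ} (h : pfaff A < 0) :
    lvec A ⬝ᵥ lvec A < rvec A ⬝ᵥ rvec A := by
  rw [pfaff_eq] at h
  linarith

theorem dotProduct_self_nonneg_real (v : Fin 3 → ℝ) : 0 ≤ v ⬝ᵥ v :=
  Finset.sum_nonneg fun i _ => mul_self_nonneg (v i)

theorem rvec_pos {A : Matrix (Fin 4) (Fin 4) ℝ} (h : pfaff A < 0) : 0 < rvec A ⬝ᵥ rvec A :=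
  (dotProduct_self_nonneg_real _).trans_lt (lvec_lt_rvec h)

theorem unitRvec_dotProduct {A : Matrix (Fin 4) (Fin 4) ℝ} (h : pfaff A < 0) :
    unitRvec A ⬝ᵥ unitRvec A = 1 := by
  have h0 := rvec_pos h
  rw [unitRvec, smul_dotProduct, dotProduct_smul, smul_eq_mul, smul_eq_mul, ← mul_assoc,
    ← mul_inv, Real.mul_self_sqrt h0.le, inv_mul_cancel₀ h0.ne']

theorem rquat_sq_of_unit {q : Fin 3 → ℝ} (h : q ⬝ᵥ q = 1) : rquat q * rquat q = -1 := by
  rw [rquat_mul_self, h, neg_smul, one_smul]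

theorem orthPart_sq {A : Matrix (Fin 4) (Fin 4) ℝ} (h : pfaff A < 0) :
    orthPart A * orthPart A = -1 := rquat_sq_of_unit (unitRvec_dotProduct h)

theorem orthPart_eq_smul (A : Matrix (Fin 4) (Fin 4) ℝ) :
    orthPart A = (√(rvec A ⬝ᵥ rvec A))⁻¹ • rquat (rvec A) := by
  rw [orthPart, unitRvec, rquat_smul]

theorem skewPart_orthPart_comm (A : Matrix (Fin 4) (Fin 4) ℝ) :
    skewPart A * orthPart A = orthPart A * skewPart A := by
  rw [skewPart_eq, orthPart_eq_smul, Matrix.mul_smul, Matrix.smul_mul, add_mul, mul_add,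
    lquat_mul_rquat]

theorem symPart_orthPart_anticomm {A : Matrix (Fin 4) (Fin 4) ℝ} (hA : A * A = -1) :
    symPart A * orthPart A = -(orthPart A * symPart A) := by
  rw [orthPart_eq_smul, Matrix.mul_smul, Matrix.smul_mul, symPart_rquat_anticomm hA, smul_neg]

/-- For negative `A` with orthogonal part `Q` and `A² = -1`, the matrix `A Q⁻¹` is symmetric and
positive definite, so it is `exp S` for a symmetric `S`. This is `cosh S`, and `sinh S` is `-(symPart A * orthPart A)`. -/
def coshPart (A : Matrix (Fin 4) (Fin 4) ℝ) : Matrix (Fin 4) (Fin 4) ℝ :=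
  -(skewPart A * orthPart A)

theorem coshPart_eq {A : Matrix (Fin 4) (Fin 4) ℝ} (h : pfaff A < 0) :
    coshPart A = √(rvec A ⬝ᵥ rvec A) • (1 : Matrix (Fin 4) (Fin 4) ℝ) -
      lquat (lvec A) * orthPart A := by
  have h1 : rquat (rvec A) = √(rvec A ⬝ᵥ rvec A) • orthPart A := by
    rw [orthPart_eq_smul, smul_smul, mul_inv_cancel₀ (Real.sqrt_pos.2 (rvec_pos h)).ne', one_smul]
  rw [coshPart, skewPart_eq, h1, add_mul, Matrix.smul_mul, orthPart_sq h, smul_neg]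
  abel

/-- The matrix `coshPart A` has the form `r - T` with `T² = p` a scalar smaller than `r²`, so that
`a (r + T) + b` inverts `a (r - T) + b` up to a positive scalar. -/
theorem isUnit_smul_coshPart_add {A : Matrix (Fin 4) (Fin 4) ℝ} (h : pfaff A < 0) {a b : ℝ}
    (ha : 0 ≤ a) (hb : 0 < b) : IsUnit (a • coshPart A + b • 1) := by
  set r := √(rvec A ⬝ᵥ rvec A) with hr
  set T := lquat (lvec A) * orthPart A with hT
  have hTT : T * T = (lvec A ⬝ᵥ lvec A) • 1 := by
    rw [hT, Matrix.mul_assoc, ← Matrix.mul_assoc (orthPart A), orthPart, ← lquat_mul_rquat,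
      ← orthPart, Matrix.mul_assoc (lquat _), orthPart_sq h, ← Matrix.mul_assoc, lquat_mul_self]
    simp
  have hr0 : 0 ≤ r := Real.sqrt_nonneg _
  have hrr : r * r = rvec A ⬝ᵥ rvec A := Real.mul_self_sqrt (rvec_pos h).le
  have hlt := lvec_lt_rvec h
  have hd : 0 < (a * r + b) ^ 2 - a ^ 2 * (lvec A ⬝ᵥ lvec A) := by
    have : 0 ≤ a ^ 2 * (r * r - lvec A ⬝ᵥ lvec A) := mul_nonneg (sq_nonneg a) (by linarith)
    have : 0 ≤ a * r * b := by positivity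
    nlinarith [pow_pos hb 2]
  have hmul : (a • coshPart A + b • 1) * ((a * r + b) • 1 + a • T) =
      ((a * r + b) ^ 2 - a ^ 2 * (lvec A ⬝ᵥ lvec A)) • (1 : Matrix (Fin 4) (Fin 4) ℝ) := by
    rw [coshPart_eq h, ← hr, ← hT,
      show a • (r • (1 : Matrix (Fin 4) (Fin 4) ℝ) - T) + b • 1 = (a * r + b) • 1 - a • T by module]
    simp only [sub_mul, mul_add, Matrix.smul_mul, Matrix.mul_smul, Matrix.one_mul, Matrix.mul_one,
      hTT]
    module
  rw [Matrix.isUnit_iff_isUnit_det]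
  refine isUnit_of_mul_isUnit_left (y := (((a * r + b) • 1 + a • T) : Matrix _ _ ℝ).det) ?_
  rw [← det_mul, hmul, det_smul, det_one, mul_one, isUnit_iff_ne_zero]
  exact pow_ne_zero _ hd.ne'

/-- The matrix `E + t O`, where `E = 1 + coshPart A` commutes with `orthPart A` and
`O = -(symPart A * orthPart A)` anticommutes with it. For `t = 1` it is `1 - A * orthPart A`. -/
def intertwiner (A : Matrix (Fin 4) (Fin 4) ℝ) (t : ℝ) : Matrix (Fin 4) (Fin 4) ℝ :=
  1 + coshPart A + t • -(symPart A * orthPart A)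

/-- With `C = cosh S` and `O² = C² - 1`, the product `(1 + C + t O) (1 + C - t O)` equals
`(1 + C) ((1 - t²) C + (1 + t²))`. -/
theorem isUnit_intertwiner {A : Matrix (Fin 4) (Fin 4) ℝ} (hA : A * A = -1) (h : pfaff A < 0)
    {t : ℝ} (ht : t ^ 2 ≤ 1) : IsUnit (intertwiner A t) := by
  have hQ := orthPart_sq h
  have hK := skewPart_orthPart_comm A
  have hS := symPart_orthPart_anticomm hA
  have hKS := skewPart_symPart_anticomm hA
  have hsq := skewPart_sq_add_symPart_sq hA
  set C := coshPart A with hC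
  set Q := orthPart A
  set K := skewPart A
  set S := symPart A
  -- As `C² - 1 = (S Q)²` and `C` commutes with `S Q`, the product below is a polynomial in `C`.
  have e1 : S * Q * (K * Q) = -(S * K) := by
    rw [Matrix.mul_assoc, ← Matrix.mul_assoc Q, ← hK, Matrix.mul_assoc K, hQ]; simp
  have e2 : K * Q * (S * Q) = -(S * K) := by
    rw [Matrix.mul_assoc, ← Matrix.mul_assoc Q, ← neg_eq_iff_eq_neg.2 hS, neg_mul, Matrix.mul_assoc,
      hQ, eq_neg_of_add_eq_zero_right hKS]; simp
  have e3 : S * Q * (S * Q) = S * S := by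
    rw [Matrix.mul_assoc, ← Matrix.mul_assoc Q, ← neg_eq_iff_eq_neg.2 hS, neg_mul, Matrix.mul_assoc,
      hQ]; simp
  have e4 : K * Q * (K * Q) = -(K * K) := by
    rw [Matrix.mul_assoc, ← Matrix.mul_assoc Q, ← hK, Matrix.mul_assoc K, hQ]; simp
  have hSS : S * S = C * C - 1 := by
    rw [hC, coshPart, neg_mul_neg, e4, sub_eq_add_neg, ← hsq]; abel
  have hcomm : C * (S * Q) = S * Q * C := by
    rw [hC, coshPart, neg_mul, mul_neg, e1, e2]
  have hmul : intertwiner A t * intertwiner A (-t) =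
      ((1 : ℝ) • C + (1 : ℝ) • 1) * ((1 - t ^ 2) • C + (1 + t ^ 2) • 1) := by
    simp only [intertwiner, ← hC]
    rw [show symPart A * orthPart A = S * Q from rfl]
    simp only [mul_add, add_mul, Matrix.smul_mul, Matrix.mul_smul, Matrix.one_mul, Matrix.mul_one,
      mul_neg, neg_mul, smul_neg, neg_smul, hcomm, e3, hSS]
    module
  have hu := (isUnit_smul_coshPart_add h zero_le_one zero_lt_one).mul
    (isUnit_smul_coshPart_add h (a := 1 - t ^ 2) (b := 1 + t ^ 2) (by linarith) (by positivity))
  rw [← hC, ← hmul, Matrix.isUnit_iff_isUnit_det, det_mul] at hu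
  exact (Matrix.isUnit_iff_isUnit_det _).2 (isUnit_of_mul_isUnit_left hu)

theorem coshPart_orthPart_comm (A : Matrix (Fin 4) (Fin 4) ℝ) :
    (1 + coshPart A) * orthPart A = orthPart A * (1 + coshPart A) := by
  rw [coshPart, add_mul, mul_add, neg_mul, mul_neg, Matrix.one_mul, Matrix.mul_one,
    ← Matrix.mul_assoc, skewPart_orthPart_comm]

theorem odd_orthPart_anticomm {A : Matrix (Fin 4) (Fin 4) ℝ} (hA : A * A = -1) :
    -(symPart A * orthPart A) * orthPart A = -(orthPart A * -(symPart A * orthPart A)) := by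
  rw [neg_mul, mul_neg, neg_neg, ← Matrix.mul_assoc (orthPart A),
    ← neg_eq_iff_eq_neg.2 (symPart_orthPart_anticomm hA), neg_mul]

theorem mul_intertwiner_one {A : Matrix (Fin 4) (Fin 4) ℝ} (hA : A * A = -1) (h : pfaff A < 0) :
    A * intertwiner A 1 = intertwiner A 1 * orthPart A := by
  have h1 : intertwiner A 1 = 1 - A * orthPart A := by
    conv_rhs => rw [← skewPart_add_symPart A]
    rw [intertwiner, coshPart, one_smul, show orthPart (skewPart A + symPart A) = orthPart A by
      rw [skewPart_add_symPart], add_mul]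
    abel
  rw [h1, mul_sub, sub_mul, ← Matrix.mul_assoc, hA, Matrix.mul_assoc A, orthPart_sq h]
  simp only [Matrix.one_mul, Matrix.mul_one, neg_mul, mul_neg]
  abel

/-- The path of complex structures from `orthPart A` at `t = 0` to `A` at `t = 1`. -/
def deform (A : Matrix (Fin 4) (Fin 4) ℝ) (t : ℝ) : Matrix (Fin 4) (Fin 4) ℝ :=
  intertwiner A t * orthPart A * (intertwiner A t)⁻¹

theorem deform_mul_intertwiner {A : Matrix (Fin 4) (Fin 4) ℝ} (hA : A * A = -1) (h : pfaff A < 0)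
    {t : ℝ} (ht : t ^ 2 ≤ 1) :
    deform A t * intertwiner A t = intertwiner A t * orthPart A := by
  have := (Matrix.isUnit_iff_isUnit_det _).1 (isUnit_intertwiner hA h ht)
  rw [deform, Matrix.mul_assoc, nonsing_inv_mul _ this, Matrix.mul_one]

theorem deform_one {A : Matrix (Fin 4) (Fin 4) ℝ} (hA : A * A = -1) (h : pfaff A < 0) :
    deform A 1 = A := by
  have := (Matrix.isUnit_iff_isUnit_det _).1 (isUnit_intertwiner hA h (t := 1) (by norm_num))
  rw [deform, ← mul_intertwiner_one hA h, Matrix.mul_assoc, mul_nonsing_inv _ this, Matrix.mul_one]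

theorem deform_zero {A : Matrix (Fin 4) (Fin 4) ℝ} (hA : A * A = -1) (h : pfaff A < 0) :
    deform A 0 = orthPart A := by
  have := (Matrix.isUnit_iff_isUnit_det _).1 (isUnit_intertwiner hA h (t := 0) (by norm_num))
  have h1 : intertwiner A 0 * orthPart A = orthPart A * intertwiner A 0 := by
    rw [intertwiner, zero_smul, add_zero, coshPart_orthPart_comm]
  rw [deform, h1, Matrix.mul_assoc, mul_nonsing_inv _ this, Matrix.mul_one]

theorem deform_sq {A : Matrix (Fin 4) (Fin 4) ℝ} (hA : A * A = -1) (h : pfaff A < 0) {t : ℝ}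
    (ht : t ^ 2 ≤ 1) : deform A t * deform A t = -1 := by
  have := (Matrix.isUnit_iff_isUnit_det _).1 (isUnit_intertwiner hA h ht)
  conv_lhs => rw [deform]
  rw [Matrix.mul_assoc, Matrix.mul_assoc, ← Matrix.mul_assoc (intertwiner A t)⁻¹,
    ← Matrix.mul_assoc (intertwiner A t)⁻¹, nonsing_inv_mul _ this, Matrix.one_mul,
    ← Matrix.mul_assoc (orthPart A), orthPart_sq h, neg_mul, Matrix.one_mul, mul_neg,
    mul_nonsing_inv _ this]

/-! ### Integrability along the deformation -/

/-- The bracket of the Heisenberg algebra in the real coordinates `z₁, z₂` of the arguments and `z₃`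
of the value. -/
def brk : (Fin 4 → ℝ) →ₗ[ℝ] (Fin 4 → ℝ) →ₗ[ℝ] (Fin 2 → ℝ) :=
  LinearMap.mk₂ ℝ (fun X Y => ![X 0 * Y 2 - X 1 * Y 3 - (Y 0 * X 2 - Y 1 * X 3),
      X 0 * Y 3 + X 1 * Y 2 - (Y 0 * X 3 + Y 1 * X 2)])
    (fun X X' Y => by ext k; fin_cases k <;> simp <;> ring)
    (fun t X Y => by ext k; fin_cases k <;> simp <;> ring)
    (fun X Y Y' => by ext k; fin_cases k <;> simp <;> ring)
    (fun t X Y => by ext k; fin_cases k <;> simp <;> ring)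

theorem brk_apply (X Y : Fin 4 → ℝ) :
    brk X Y = ![X 0 * Y 2 - X 1 * Y 3 - (Y 0 * X 2 - Y 1 * X 3),
      X 0 * Y 3 + X 1 * Y 2 - (Y 0 * X 3 + Y 1 * X 2)] := rfl

/-- The real and imaginary parts of the bracket are self-dual two-forms, so they are preserved up to
scale by anti-self-dual matrices. -/
theorem brk_rquat (q : Fin 3 → ℝ) (X Y : Fin 4 → ℝ) :
    brk (rquat q *ᵥ X) (rquat q *ᵥ Y) = (q ⬝ᵥ q) • brk X Y := by
  ext k
  fin_cases k <;>
    simp [brk_apply, rquat, dotProduct, Fin.sum_univ_four, Fin.sum_univ_three] <;> ring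

/-- The Newlander-Nirenberg condition for endomorphisms `A` of `ℝ⁴` and `j` of the centre. -/
def IsIntegrable (A : Matrix (Fin 4) (Fin 4) ℝ) (j : Matrix (Fin 2) (Fin 2) ℝ) : Prop :=
  ∀ X Y, brk (A *ᵥ X) (A *ᵥ Y) =
    brk X Y + j *ᵥ brk (A *ᵥ X) Y + j *ᵥ brk X (A *ᵥ Y)

theorem brk_skew {Q : Matrix (Fin 4) (Fin 4) ℝ} (hQ : Q * Q = -1)
    (hb : ∀ X Y, brk (Q *ᵥ X) (Q *ᵥ Y) = brk X Y) (X Y : Fin 4 → ℝ) :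
    brk (Q *ᵥ X) Y = -brk X (Q *ᵥ Y) := by
  rw [← hb X, mulVec_mulVec, hQ, neg_mulVec, one_mulVec, map_neg, neg_neg]

theorem isIntegrable_of_invariant {Q : Matrix (Fin 4) (Fin 4) ℝ} (hQ : Q * Q = -1)
    (hb : ∀ X Y, brk (Q *ᵥ X) (Q *ᵥ Y) = brk X Y) (j : Matrix (Fin 2) (Fin 2) ℝ) :
    IsIntegrable Q j := by
  intro X Y
  rw [hb, brk_skew hQ hb, mulVec_neg]
  abel

/-- The integrability defect of `(G Q G⁻¹, j)` pulled back by `G = E + t O`. The terms of even degree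
in `O` cancel because the bracket is `Q`-invariant, leaving a multiple of `t`. -/
theorem integrability_defect {Q E O : Matrix (Fin 4) (Fin 4) ℝ} (hQ : Q * Q = -1)
    (hb : ∀ X Y, brk (Q *ᵥ X) (Q *ᵥ Y) = brk X Y) (hE : E * Q = Q * E) (hO : O * Q = -(Q * O))
    (j : Matrix (Fin 2) (Fin 2) ℝ) (t : ℝ) (X Y : Fin 4 → ℝ) :
    brk ((E + t • O) *ᵥ (Q *ᵥ X)) ((E + t • O) *ᵥ (Q *ᵥ Y)) -
      (brk ((E + t • O) *ᵥ X) ((E + t • O) *ᵥ Y) +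
        j *ᵥ brk ((E + t • O) *ᵥ (Q *ᵥ X)) ((E + t • O) *ᵥ Y) +
        j *ᵥ brk ((E + t • O) *ᵥ X) ((E + t • O) *ᵥ (Q *ᵥ Y))) =
      (-2 * t) • (brk (O *ᵥ X) (E *ᵥ Y) + brk (E *ᵥ X) (O *ᵥ Y) +
        j *ᵥ brk (O *ᵥ X) (Q *ᵥ (E *ᵥ Y)) + j *ᵥ brk (Q *ᵥ (E *ᵥ X)) (O *ᵥ Y)) := by
  have h1 : ∀ v, E *ᵥ (Q *ᵥ v) = Q *ᵥ (E *ᵥ v) := fun v => by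
    rw [mulVec_mulVec, hE, mulVec_mulVec]
  have h2 : ∀ v, O *ᵥ (Q *ᵥ v) = -(Q *ᵥ (O *ᵥ v)) := fun v => by
    rw [mulVec_mulVec, hO, neg_mulVec, mulVec_mulVec]
  simp only [add_mulVec, smul_mulVec, h1, h2, map_add, map_smul, map_neg, LinearMap.add_apply,
    LinearMap.smul_apply, LinearMap.neg_apply, hb, brk_skew hQ hb, mulVec_add, mulVec_smul,
    mulVec_neg, smul_neg]
  module

theorem isIntegrable_iff_of_intertwines {A Q G : Matrix (Fin 4) (Fin 4) ℝ} (hG : IsUnit G)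
    (h : A * G = G * Q) (j : Matrix (Fin 2) (Fin 2) ℝ) :
    IsIntegrable A j ↔ ∀ X Y, brk (G *ᵥ (Q *ᵥ X)) (G *ᵥ (Q *ᵥ Y)) =
      brk (G *ᵥ X) (G *ᵥ Y) + j *ᵥ brk (G *ᵥ (Q *ᵥ X)) (G *ᵥ Y) +
        j *ᵥ brk (G *ᵥ X) (G *ᵥ (Q *ᵥ Y)) := by
  have hv : ∀ v, G *ᵥ (Q *ᵥ v) = A *ᵥ (G *ᵥ v) := fun v => by
    rw [mulVec_mulVec, ← h, mulVec_mulVec]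
  simp only [hv]
  have hs : Function.Surjective G.mulVec := mulVec_surjective_iff_isUnit.2 hG
  exact ⟨fun H X Y => H _ _, fun H => hs.forall₂.2 H⟩

theorem orthPart_invariant {A : Matrix (Fin 4) (Fin 4) ℝ} (h : pfaff A < 0) (X Y : Fin 4 → ℝ) :
    brk (orthPart A *ᵥ X) (orthPart A *ᵥ Y) = brk X Y := by
  rw [orthPart, brk_rquat, unitRvec_dotProduct h, one_smul]

theorem isIntegrable_deform {A : Matrix (Fin 4) (Fin 4) ℝ} (hA : A * A = -1) (h : pfaff A < 0)
    {j : Matrix (Fin 2) (Fin 2) ℝ} (hN : IsIntegrable A j) {t : ℝ} (ht : t ^ 2 ≤ 1) :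
    IsIntegrable (deform A t) j := by
  rw [isIntegrable_iff_of_intertwines (isUnit_intertwiner hA h ht) (deform_mul_intertwiner hA h ht)]
  rw [isIntegrable_iff_of_intertwines (isUnit_intertwiner hA h (by norm_num))
    (mul_intertwiner_one hA h)] at hN
  intro X Y
  have hd := integrability_defect (orthPart_sq h) (orthPart_invariant h) (coshPart_orthPart_comm A)
    (odd_orthPart_anticomm hA) j
  have h1 := hd 1 X Y
  rw [← intertwiner, sub_eq_zero.2 (hN X Y), eq_comm, smul_eq_zero_iff_right (by norm_num)] at h1
  have h2 := hd t X Y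
  rw [h1, smul_zero, sub_eq_zero] at h2
  exact h2

/-! ### Continuity of the deformation -/

theorem continuous_inv_of_isUnit {X : Type*} [TopologicalSpace X]
    {F : X → Matrix (Fin 4) (Fin 4) ℝ} (hF : Continuous F) (hu : ∀ x, IsUnit (F x)) :
    Continuous fun x => (F x)⁻¹ := by
  simp_rw [Matrix.inv_def, Ring.inverse_eq_inv']
  exact (hF.matrix_det.inv₀ fun x => ((Matrix.isUnit_iff_isUnit_det _).1 (hu x)).ne_zero).smul
    hF.matrix_adjugate

theorem continuous_rquat : Continuous rquat := by
  refine continuous_matrix fun i k => ?_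
  fin_cases i <;> fin_cases k <;> simp [rquat] <;> fun_prop

theorem continuous_rvec : Continuous rvec := by
  refine continuous_pi fun k => ?_
  fin_cases k <;> simp [rvec] <;> fun_prop

theorem continuous_pfaff : Continuous pfaff := by
  unfold pfaff
  fun_prop

theorem continuous_unitRvec {X : Type*} [TopologicalSpace X] {F : X → Matrix (Fin 4) (Fin 4) ℝ}
    (hF : Continuous F) (h : ∀ x, pfaff (F x) < 0) : Continuous fun x => unitRvec (F x) := by
  have h1 : Continuous fun x => rvec (F x) := continuous_rvec.comp hF
  unfold unitRvec
  exact ((h1.dotProduct h1).sqrt.inv₀ fun x => (Real.sqrt_pos.2 (rvec_pos (h x))).ne').smul h1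

theorem continuous_orthPart {X : Type*} [TopologicalSpace X] {F : X → Matrix (Fin 4) (Fin 4) ℝ}
    (hF : Continuous F) (h : ∀ x, pfaff (F x) < 0) : Continuous fun x => orthPart (F x) :=
  continuous_rquat.comp (continuous_unitRvec hF h)

theorem continuous_intertwiner {X : Type*} [TopologicalSpace X]
    {F : X → Matrix (Fin 4) (Fin 4) ℝ} {τ : X → ℝ} (hF : Continuous F) (hτ : Continuous τ)
    (h : ∀ x, pfaff (F x) < 0) : Continuous fun x => intertwiner (F x) (τ x) := by
  have h1 := continuous_orthPart hF h
  unfold intertwiner coshPart skewPart symPart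
  fun_prop

theorem continuous_deform {X : Type*} [TopologicalSpace X]
    {F : X → Matrix (Fin 4) (Fin 4) ℝ} {τ : X → ℝ} (hF : Continuous F) (hτ : Continuous τ)
    (hA : ∀ x, F x * F x = -1) (h : ∀ x, pfaff (F x) < 0) (hτ1 : ∀ x, τ x ^ 2 ≤ 1) :
    Continuous fun x => deform (F x) (τ x) := by
  have h1 := continuous_orthPart hF h
  have h2 := continuous_intertwiner hF hτ h
  have h3 := continuous_inv_of_isUnit h2 fun x => isUnit_intertwiner (hA x) (h x) (hτ1 x)
  unfold deform
  fun_prop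

theorem unitInterval_sq_le_one (t : unitInterval) : (t : ℝ) ^ 2 ≤ 1 :=
  pow_le_one₀ t.2.1 t.2.2

/-- The Pfaffian never vanishes on complex structures, so its sign is constant along the path. -/
theorem pfaff_deform_neg {A : Matrix (Fin 4) (Fin 4) ℝ} (hA : A * A = -1) (h : pfaff A < 0)
    (t : unitInterval) : pfaff (deform A t) < 0 := by
  by_contra! ht
  have hc : Continuous fun s : unitInterval => pfaff (deform A s) :=
    continuous_pfaff.comp (continuous_deform continuous_const continuous_subtype_val (fun _ => hA)
      (fun _ => h) unitInterval_sq_le_one)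
  obtain ⟨s, hs⟩ := mem_range_of_exists_le_of_exists_ge hc (c := 0)
    ⟨1, by simpa [deform_one hA h] using h.le⟩ ⟨t, ht⟩
  exact pfaff_ne_zero (deform_sq hA h (unitInterval_sq_le_one s)) hs

/-! ### The space of triples of blocks is homotopy equivalent to the sphere -/

/-- The complex structure of the plane with first column `(a, c)`, for `c ≠ 0`. -/
def centreStr (a c : ℝ) : Matrix (Fin 2) (Fin 2) ℝ := !![a, -(1 + a ^ 2) / c; c, -a]

theorem centreStr_sq (a : ℝ) {c : ℝ} (hc : c ≠ 0) : centreStr a c * centreStr a c = -1 := by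
  ext i k
  fin_cases i <;> fin_cases k <;> simp [centreStr, Matrix.mul_apply, Fin.sum_univ_two] <;>
    field_simp <;> ring

theorem eq_centreStr {j : Matrix (Fin 2) (Fin 2) ℝ} (hj : j * j = -1) (hc : j 1 0 ≠ 0) :
    j = centreStr (j 0 0) (j 1 0) := by
  have h00 := congrFun (congrFun hj 0) 0
  have h10 := congrFun (congrFun hj 1) 0
  simp [Matrix.mul_apply, Fin.sum_univ_two] at h00 h10
  have h1 : j 1 1 = -j 0 0 := by
    apply mul_left_cancel₀ hc
    linarith
  ext i k
  fin_cases i <;> fin_cases k <;> simp [centreStr, h1]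
  field_simp
  linarith

/-- The triples of blocks `(A, B, j)` of the elements of `CMinus`. -/
def model : Set (Matrix (Fin 4) (Fin 4) ℝ × Matrix (Fin 2) (Fin 4) ℝ × Matrix (Fin 2) (Fin 2) ℝ) :=
  {x | (x.1 * x.1 = -1 ∧ pfaff x.1 < 0) ∧ (x.2.2 * x.2.2 = -1 ∧ x.2.2 1 0 < 0) ∧
    x.2.1 * x.1 + x.2.2 * x.2.1 = 0 ∧ IsIntegrable x.1 x.2.2}

/-- The block `B` is transported along the path by the intertwiners, and scaled to zero. -/
theorem deform_mem_model (x : model) (t : unitInterval) :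
    (deform x.1.1 t,
      (t : ℝ) • (x.1.2.1 * intertwiner x.1.1 1 * (intertwiner x.1.1 t)⁻¹), x.1.2.2) ∈ model := by
  obtain ⟨⟨A, B, j⟩, ⟨hA, h⟩, hj, hB, hN⟩ := x
  dsimp only at hA h hj hB hN ⊢
  have ht := unitInterval_sq_le_one t
  refine ⟨⟨deform_sq hA h ht, pfaff_deform_neg hA h t⟩, hj, ?_, isIntegrable_deform hA h hN ht⟩
  have hu := (Matrix.isUnit_iff_isUnit_det _).1 (isUnit_intertwiner hA h ht)
  have key : B * intertwiner A 1 * (intertwiner A t)⁻¹ * deform A t =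
      B * A * intertwiner A 1 * (intertwiner A t)⁻¹ := by
    rw [deform, Matrix.mul_assoc (B * _), ← Matrix.mul_assoc (intertwiner A t)⁻¹,
      ← Matrix.mul_assoc (intertwiner A t)⁻¹, nonsing_inv_mul _ hu, Matrix.one_mul,
      Matrix.mul_assoc B A, mul_intertwiner_one hA h]
    simp only [Matrix.mul_assoc]
  rw [Matrix.smul_mul, key, eq_neg_of_add_eq_zero_left hB]
  simp [Matrix.mul_assoc]

theorem rquat_mem_model {q : Fin 3 → ℝ} (hq : q ⬝ᵥ q = 1) {a c : ℝ} (hc : c < 0) :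
    (rquat q, 0, centreStr a c) ∈ model := by
  refine ⟨⟨rquat_sq_of_unit hq, ?_⟩, ⟨centreStr_sq a hc.ne, hc⟩, by simp,
    isIntegrable_of_invariant (rquat_sq_of_unit hq) (fun X Y => ?_) _⟩
  · rw [pfaff_rquat, hq]
    norm_num
  · rw [brk_rquat, hq, one_smul]

theorem dotProduct_eq_one_of_mem_sphere
    (n : Metric.sphere (0 : EuclideanSpace ℝ (Fin 3)) 1) : n.1.ofLp ⬝ᵥ n.1.ofLp = 1 := by
  have h := EuclideanSpace.real_norm_sq_eq n.1
  rw [norm_eq_of_mem_sphere n] at h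
  simp only [dotProduct, ← pow_two]
  linarith

theorem toLp_mem_sphere {q : Fin 3 → ℝ} (hq : q ⬝ᵥ q = 1) :
    WithLp.toLp 2 q ∈ Metric.sphere (0 : EuclideanSpace ℝ (Fin 3)) 1 := by
  have h := EuclideanSpace.real_norm_sq_eq (WithLp.toLp 2 q)
  simp only [dotProduct, ← pow_two] at hq
  rw [mem_sphere_zero_iff_norm, ← pow_eq_one_iff_of_nonneg (norm_nonneg _) two_ne_zero, h]
  exact hq

/-- The direction of the anti-self-dual part of `A`. -/
def modelToSphere : C(model, Metric.sphere (0 : EuclideanSpace ℝ (Fin 3)) 1) where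
  toFun x := ⟨WithLp.toLp 2 (unitRvec x.1.1), toLp_mem_sphere (unitRvec_dotProduct x.2.1.2)⟩
  continuous_toFun := by
    refine Continuous.subtype_mk ((PiLp.continuous_toLp 2 _).comp ?_) _
    exact continuous_unitRvec (continuous_fst.comp continuous_subtype_val) fun x => x.2.1.2

/-- The orthogonal complex structures of `ℝ⁴`, together with `-i` on the centre. -/
def sphereToModel : C(Metric.sphere (0 : EuclideanSpace ℝ (Fin 3)) 1, model) where
  toFun n := ⟨(rquat n.1.ofLp, 0, centreStr 0 (-1)),
    rquat_mem_model (dotProduct_eq_one_of_mem_sphere n) (by norm_num)⟩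
  continuous_toFun := by
    refine Continuous.subtype_mk (Continuous.prodMk (continuous_rquat.comp ?_) continuous_const) _
    fun_prop

theorem continuous_centreStr {X : Type*} [TopologicalSpace X] {a c : X → ℝ} (ha : Continuous a)
    (hc : Continuous c) (h : ∀ x, c x ≠ 0) : Continuous fun x => centreStr (a x) (c x) := by
  refine continuous_matrix fun i k => ?_
  fin_cases i <;> fin_cases k <;> simp [centreStr]
  · exact ha
  · exact (by fun_prop : Continuous fun x => -(a x) ^ 2 + -1).div hc h
  · exact hc
  · exact ha.neg

/-- The map replacing `A` by its orthogonal part and `B` by zero. -/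
def orthModel : C(model, model) where
  toFun x := ⟨(orthPart x.1.1, 0, centreStr (x.1.2.2 0 0) (x.1.2.2 1 0)),
    rquat_mem_model (unitRvec_dotProduct x.2.1.2) x.2.2.1.2⟩
  continuous_toFun := by
    refine Continuous.subtype_mk (Continuous.prodMk
      (continuous_orthPart (by fun_prop) fun x => x.2.1.2) (Continuous.prodMk continuous_const
      (continuous_centreStr (by fun_prop) (by fun_prop) fun x => x.2.2.1.2.ne))) _

/-- The homotopy that deforms `A` to its orthogonal part and keeps `j`. -/
def homotopyToOrth : ContinuousMap.Homotopy orthModel (ContinuousMap.id model) where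
  toFun p := ⟨_, deform_mem_model p.2 p.1⟩
  continuous_toFun := by
    have hF : Continuous fun p : unitInterval × model => p.2.1.1 := by fun_prop
    have hτ : Continuous fun p : unitInterval × model => (p.1 : ℝ) := by fun_prop
    have h1 := continuous_deform hF hτ (fun p => p.2.2.1.1) (fun p => p.2.2.1.2)
      fun p => unitInterval_sq_le_one p.1
    have h2 := continuous_inv_of_isUnit (continuous_intertwiner hF hτ fun p => p.2.2.1.2)
      fun p => isUnit_intertwiner p.2.2.1.1 p.2.2.1.2 (unitInterval_sq_le_one p.1)
    have h3 := continuous_intertwiner hF (continuous_const (y := (1 : ℝ))) fun p => p.2.2.1.2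
    exact Continuous.subtype_mk (by fun_prop) _
  map_zero_left x := by
    apply Subtype.ext
    refine Prod.ext ?_ (Prod.ext ?_ ?_)
    · exact deform_zero x.2.1.1 x.2.1.2
    · exact zero_smul _ _
    · exact eq_centreStr x.2.2.1.1 x.2.2.1.2.ne
  map_one_left x := by
    apply Subtype.ext
    refine Prod.ext ?_ (Prod.ext ?_ rfl)
    · exact deform_one x.2.1.1 x.2.1.2
    · have := (Matrix.isUnit_iff_isUnit_det _).1
        (isUnit_intertwiner x.2.1.1 x.2.1.2 (t := 1) (by norm_num))
      change (1 : ℝ) • (x.1.2.1 * intertwiner x.1.1 1 * (intertwiner x.1.1 1)⁻¹) = x.1.2.1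
      rw [Matrix.mul_assoc, mul_nonsing_inv _ this, Matrix.mul_one, one_smul]

theorem segment_neg (t : unitInterval) {c : ℝ} (hc : c < 0) :
    (1 - (t : ℝ)) * (-1) + t * c < 0 :=
  (convex_Iio (0 : ℝ)) (Set.mem_Iio.2 neg_one_lt_zero) hc (sub_nonneg.2 t.2.2) t.2.1 (by ring)

theorem orthPart_centre_mem_model (x : model) (t : unitInterval) :
    (orthPart x.1.1, 0, centreStr (t * x.1.2.2 0 0) ((1 - (t : ℝ)) * (-1) + t * x.1.2.2 1 0)) ∈
      model :=
  rquat_mem_model (unitRvec_dotProduct x.2.1.2) (segment_neg t x.2.2.1.2)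

/-- The homotopy that moves `j` to `-i`, linearly in the first column of `j`. -/
def homotopyCentre : ContinuousMap.Homotopy (sphereToModel.comp modelToSphere) orthModel where
  toFun p := ⟨_, orthPart_centre_mem_model p.2 p.1⟩
  continuous_toFun := by
    have h1 : Continuous fun p : unitInterval × model => orthPart p.2.1.1 :=
      continuous_orthPart (by fun_prop) fun p => p.2.2.1.2
    have h2 : Continuous fun p : unitInterval × model => centreStr (p.1 * p.2.1.2.2 0 0)
        ((1 - (p.1 : ℝ)) * (-1) + p.1 * p.2.1.2.2 1 0) :=
      continuous_centreStr (by fun_prop) (by fun_prop) fun p => (segment_neg p.1 p.2.2.2.1.2).ne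
    exact Continuous.subtype_mk (h1.prodMk (continuous_const.prodMk h2)) _
  map_zero_left x := by
    apply Subtype.ext
    simp [sphereToModel, modelToSphere, orthPart]
  map_one_left x := by
    apply Subtype.ext
    simp [orthModel]

theorem modelToSphere_comp :
    modelToSphere.comp sphereToModel = ContinuousMap.id _ := by
  ext n : 1
  apply Subtype.ext
  have h := dotProduct_eq_one_of_mem_sphere n
  simp [modelToSphere, sphereToModel, unitRvec, rvec_rquat, h]

/-- The homotopy equivalence of `model` with the two-sphere. -/
def modelHomotopyEquiv :
    ContinuousMap.HomotopyEquiv model (Metric.sphere (0 : EuclideanSpace ℝ (Fin 3)) 1) where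
  toFun := modelToSphere
  invFun := sphereToModel
  left_inv := ⟨homotopyCentre.trans homotopyToOrth⟩
  right_inv := by rw [modelToSphere_comp]

/-! ### Endomorphisms of the Heisenberg algebra in blocks -/

/-- The real coordinates of `(z₁, z₂)` and of `z₃`. -/
def split : Heis ≃ₗ[ℝ] (Fin 4 → ℝ) × (Fin 2 → ℝ) where
  toFun z := (![(z 0).re, (z 0).im, (z 1).re, (z 1).im], ![(z 2).re, (z 2).im])
  map_add' z w := by simp
  map_smul' t z := by simp
  invFun p := (![⟨p.1 0, p.1 1⟩, ⟨p.1 2, p.1 3⟩, ⟨p.2 0, p.2 1⟩] : Fin 3 → ℂ)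
  left_inv z := heis_ext rfl rfl rfl
  right_inv p := by
    refine Prod.ext ?_ ?_ <;> ext k <;> fin_cases k <;> rfl

theorem split_apply (z : Heis) :
    split z = (![(z 0).re, (z 0).im, (z 1).re, (z 1).im], ![(z 2).re, (z 2).im]) := rfl

theorem split_lie (X Y : Heis) : split ⁅X, Y⁆ = (0, brk (split X).1 (split Y).1) := by
  refine Prod.ext ?_ ?_
  · ext k
    fin_cases k <;> rfl
  · ext k
    fin_cases k <;> simp [split_apply, brk_apply, lie_two_coord]

theorem split_central (c : ℂ) : (split (central c)).1 = 0 := by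
  ext k
  fin_cases k <;> rfl

theorem split_symm_zero (z : Fin 2 → ℝ) : split.symm (0, z) = central ⟨z 0, z 1⟩ := rfl

instance : FiniteDimensional ℝ Heis := stdBasis.finiteDimensional_of_finite

/-- The endomorphism `(v, z) ↦ (A v, B v + j z)` in the coordinates `split`. -/
def ofBlocks (A : Matrix (Fin 4) (Fin 4) ℝ) (B : Matrix (Fin 2) (Fin 4) ℝ)
    (j : Matrix (Fin 2) (Fin 2) ℝ) : Heis →L[ℝ] Heis :=
  LinearMap.toContinuousLinearMap (split.symm.toLinearMap ∘ₗ
    ((A.mulVecLin ∘ₗ LinearMap.fst ℝ _ _).prod (B.mulVecLin.coprod j.mulVecLin)) ∘ₗ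
      split.toLinearMap)

theorem split_ofBlocks (A : Matrix (Fin 4) (Fin 4) ℝ) (B : Matrix (Fin 2) (Fin 4) ℝ)
    (j : Matrix (Fin 2) (Fin 2) ℝ) (X : Heis) :
    split (ofBlocks A B j X) = (A *ᵥ (split X).1, B *ᵥ (split X).1 + j *ᵥ (split X).2) := by
  simp [ofBlocks]

/-- The blocks of an endomorphism. The block from the centre to `ℝ⁴` is left out, since it is zero for
a complex structure. -/
def blocks (J : Heis →L[ℝ] Heis) :
    Matrix (Fin 4) (Fin 4) ℝ × Matrix (Fin 2) (Fin 4) ℝ × Matrix (Fin 2) (Fin 2) ℝ :=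
  (Matrix.of fun i k => (split (J (split.symm (Pi.single k 1, 0)))).1 i,
    Matrix.of fun i k => (split (J (split.symm (Pi.single k 1, 0)))).2 i,
    Matrix.of fun i k => (split (J (split.symm (0, Pi.single k 1)))).2 i)

theorem blocks_ofBlocks (A : Matrix (Fin 4) (Fin 4) ℝ) (B : Matrix (Fin 2) (Fin 4) ℝ)
    (j : Matrix (Fin 2) (Fin 2) ℝ) : blocks (ofBlocks A B j) = (A, B, j) := by
  refine Prod.ext ?_ (Prod.ext ?_ ?_) <;> ext i k <;> simp [blocks, split_ofBlocks]

theorem IsComplexStructure.ofBlocks_blocks {J : Heis →L[ℝ] Heis} (hJ : IsComplexStructure J) :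
    ofBlocks (blocks J).1 (blocks J).2.1 (blocks J).2.2 = J := by
  have hz : ∀ z, (split (J (split.symm (0, z)))).1 = 0 := fun z => by
    obtain ⟨c, hc⟩ := hJ.map_central ⟨z 0, z 1⟩
    rw [split_symm_zero, hc, split_central]
  apply ContinuousLinearMap.coe_injective
  have key : split.toLinearMap ∘ₗ (ofBlocks (blocks J).1 (blocks J).2.1 (blocks J).2.2 :
      Heis →ₗ[ℝ] Heis) ∘ₗ split.symm.toLinearMap =
      split.toLinearMap ∘ₗ (J : Heis →ₗ[ℝ] Heis) ∘ₗ split.symm.toLinearMap := by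
    refine LinearMap.prod_ext ?_ ?_ <;> refine LinearMap.pi_ext' fun k => LinearMap.ext_ring ?_
    · refine Prod.ext ?_ ?_ <;> ext i <;> simp [split_ofBlocks, blocks]
    · refine Prod.ext ?_ ?_
      · simp [split_ofBlocks, hz]
      · ext i
        simp [split_ofBlocks, blocks]
  ext X : 1
  have := LinearMap.congr_fun key (split X)
  simpa using this

theorem isComplexStructure_ofBlocks (A : Matrix (Fin 4) (Fin 4) ℝ) (B : Matrix (Fin 2) (Fin 4) ℝ)
    (j : Matrix (Fin 2) (Fin 2) ℝ) : IsComplexStructure (ofBlocks A B j) ↔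
      A * A = -1 ∧ j * j = -1 ∧ B * A + j * B = 0 ∧ IsIntegrable A j := by
  have h1 : (∀ X, ofBlocks A B j (ofBlocks A B j X) = -X) ↔
      A * A = -1 ∧ j * j = -1 ∧ B * A + j * B = 0 := by
    have hs : ∀ X, ofBlocks A B j (ofBlocks A B j X) = -X ↔ (A * A) *ᵥ (split X).1 = -(split X).1 ∧
        (B * A + j * B) *ᵥ (split X).1 + (j * j) *ᵥ (split X).2 = -(split X).2 := fun X => by
      rw [← split.injective.eq_iff, split_ofBlocks, split_ofBlocks, map_neg, Prod.ext_iff]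
      simp only [Prod.fst_neg, Prod.snd_neg, mulVec_mulVec, mulVec_add, add_mulVec, add_assoc]
    simp only [hs]
    constructor
    · intro H
      refine ⟨?_, ?_, ?_⟩
      · refine Matrix.ext_of_mulVec_single fun k => ?_
        rw [neg_mulVec, one_mulVec]
        simpa using (H (split.symm (Pi.single k 1, 0))).1
      · refine Matrix.ext_of_mulVec_single fun k => ?_
        rw [neg_mulVec, one_mulVec]
        simpa using (H (split.symm (0, Pi.single k 1))).2
      · refine Matrix.ext_of_mulVec_single fun k => ?_
        rw [zero_mulVec]
        simpa using (H (split.symm (Pi.single k 1, 0))).2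
    · rintro ⟨hA, hj, hB⟩ X
      rw [hA, hj, hB]
      simp [neg_mulVec]
  have h2 : (∀ X Y, ⁅ofBlocks A B j X, ofBlocks A B j Y⁆ = ⁅X, Y⁆ +
      ofBlocks A B j ⁅ofBlocks A B j X, Y⁆ + ofBlocks A B j ⁅X, ofBlocks A B j Y⁆) ↔
      IsIntegrable A j := by
    have hs : ∀ X Y, ⁅ofBlocks A B j X, ofBlocks A B j Y⁆ = ⁅X, Y⁆ +
      ofBlocks A B j ⁅ofBlocks A B j X, Y⁆ + ofBlocks A B j ⁅X, ofBlocks A B j Y⁆ ↔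
      brk (A *ᵥ (split X).1) (A *ᵥ (split Y).1) = brk (split X).1 (split Y).1 +
        j *ᵥ brk (A *ᵥ (split X).1) (split Y).1 + j *ᵥ brk (split X).1 (A *ᵥ (split Y).1) := by
      intro X Y
      rw [← split.injective.eq_iff]
      simp [split_ofBlocks, split_lie]
    simp only [hs]
    refine ⟨fun H X Y => ?_, fun H X Y => H _ _⟩
    simpa using H (split.symm (X, 0)) (split.symm (Y, 0))
  rw [IsComplexStructure, h1, h2, and_assoc, and_assoc]

theorem continuous_split : Continuous split := split.toLinearMap.continuous_of_finiteDimensional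

theorem continuous_blocks : Continuous blocks := by
  have h : ∀ x : Heis, Continuous fun J : Heis →L[ℝ] Heis => split (J x) := fun x =>
    continuous_split.comp (ContinuousLinearMap.apply ℝ Heis x).continuous
  refine Continuous.prodMk ?_ (Continuous.prodMk ?_ ?_) <;>
    refine continuous_matrix fun i k => ?_
  · exact (continuous_apply i).comp (continuous_fst.comp (h _))
  · exact (continuous_apply i).comp (continuous_snd.comp (h _))
  · exact (continuous_apply i).comp (continuous_snd.comp (h _))

theorem continuous_ofBlocks : Continuous fun x : Matrix (Fin 4) (Fin 4) ℝ ×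
    Matrix (Fin 2) (Fin 4) ℝ × Matrix (Fin 2) (Fin 2) ℝ => ofBlocks x.1 x.2.1 x.2.2 := by
  refine continuous_clm_apply.2 fun X => ?_
  have hs : Continuous split.symm := split.symm.toLinearMap.continuous_of_finiteDimensional
  refine hs.comp (f := fun x : Matrix (Fin 4) (Fin 4) ℝ × Matrix (Fin 2) (Fin 4) ℝ ×
    Matrix (Fin 2) (Fin 2) ℝ => (x.1 *ᵥ (split X).1,
      x.2.1 *ᵥ (split X).1 + x.2.2 *ᵥ (split X).2)) ?_
  fun_prop

/-! ### Orientations in terms of the blocks -/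

theorem det_adapted_mul_pfaff_pos {V : Type*} [AddCommGroup V] [Module ℝ V]
    (b f : Module.Basis (Fin 2 × Fin 2) ℝ V) (A : Module.End ℝ V) (hA : A * A = -1)
    (hf : ∀ k, f (k, 1) = A (f (k, 0))) :
    0 < b.det f * pfaff (Matrix.reindex finProdFinEquiv finProdFinEquiv
      (LinearMap.toMatrix b b A)) := by
  set e : Fin 2 × Fin 2 ≃ Fin 4 := finProdFinEquiv with he
  set M := Matrix.reindex e e (LinearMap.toMatrix b b A) with hM
  set F := Matrix.reindex e e (b.toMatrix f) with hF
  have hdet : F.det = b.det f := by rw [hF, det_reindex_self, Module.Basis.det_apply]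
  have hMM : M * M = -1 := by
    rw [hM, reindex_apply, submatrix_mul_equiv, ← LinearMap.toMatrix_mul, hA]
    ext i k
    simp [Matrix.one_apply]
  have hcol : ∀ k, F.col (e (k, 1)) = M *ᵥ F.col (e (k, 0)) := fun k => by
    have h := LinearMap.toMatrix_mulVec_repr b b A (f (k, 0))
    rw [← hf] at h
    ext i
    have hi := congrFun h (e.symm i)
    rw [mulVec, dotProduct, ← e.sum_comp]
    simpa [F, M, mulVec, dotProduct, Module.Basis.toMatrix_apply] using hi.symm
  rw [← hdet]
  exact det_mul_pfaff_pos hMM (by rw [hdet]; exact (b.isUnit_det f).ne_zero) (hcol 0) (hcol 1)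

theorem inducesOrientation_neg_iff_pfaff_neg {V : Type*} [AddCommGroup V] [Module ℝ V]
    (b : Module.Basis (Fin 2 × Fin 2) ℝ V) (A : Module.End ℝ V) (hA : ∀ v, A (A v) = -v) :
    InducesOrientation A (-b.orientation) ↔
      pfaff (Matrix.reindex finProdFinEquiv finProdFinEquiv (LinearMap.toMatrix b b A)) < 0 := by
  have hsq : A * A = -1 := LinearMap.ext hA
  have := b.finiteDimensional_of_finite
  obtain ⟨f, hf⟩ := exists_adapted (n := 2) A hsq (by
    rw [Module.finrank_eq_card_basis b]; rfl)
  rw [inducesOrientation_neg_iff_det_neg A hsq b f hf]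
  exact neg_iff_neg_of_mul_pos (det_adapted_mul_pfaff_pos b f A hsq hf)

/-- On one-forms a complex structure acts by the transpose of its block `A`. -/
theorem hat_formBasis (A : Matrix (Fin 4) (Fin 4) ℝ) (B : Matrix (Fin 2) (Fin 4) ℝ)
    (j : Matrix (Fin 2) (Fin 2) ℝ) (hJ : IsComplexStructure (ofBlocks A B j)) :
    Matrix.reindex finProdFinEquiv finProdFinEquiv
      (LinearMap.toMatrix formBasis formBasis (hat hJ)) = Aᵀ := by
  have hrepr : ∀ (α : closedForms) p, formBasis.repr α p =
      (α : Module.Dual ℝ Heis) (stdBasis (p.1.castSucc, p.2)) := fun α p => rfl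
  have hc : ∀ (i : Fin 4) z, coord ((finProdFinEquiv.symm i : Fin 2 × Fin 2).1.castSucc,
      (finProdFinEquiv.symm i : Fin 2 × Fin 2).2) z = (split z).1 i := fun i z => by
    fin_cases i <;> rfl
  have hs : ∀ i : Fin 4, (split (stdBasis ((finProdFinEquiv.symm i : Fin 2 × Fin 2).1.castSucc,
      (finProdFinEquiv.symm i : Fin 2 × Fin 2).2))).1 = Pi.single i 1 := fun i => by
    ext k
    rw [← hc, coord_stdBasis]
    fin_cases i <;> fin_cases k <;> rfl
  ext i k
  rw [reindex_apply, submatrix_apply, LinearMap.toMatrix_apply, hrepr]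
  change (formBasis _ : Module.Dual ℝ Heis) (ofBlocks A B j _) = _
  rw [formBasis_apply]
  refine (hc k _).trans ?_
  rw [split_ofBlocks]
  dsimp only
  refine (congrFun (congrArg (A *ᵥ ·) (hs i)) k).trans ?_
  simp

theorem inducesOrientation_hat_iff (A : Matrix (Fin 4) (Fin 4) ℝ) (B : Matrix (Fin 2) (Fin 4) ℝ)
    (j : Matrix (Fin 2) (Fin 2) ℝ) (hJ : IsComplexStructure (ofBlocks A B j)) :
    InducesOrientation (V := closedForms) (hat hJ) (-formOrientation) ↔ pfaff A < 0 := by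
  have hsq : ∀ α, hat hJ (hat hJ α) = -α := fun α => by
    ext X
    change (α : Module.Dual ℝ Heis) (ofBlocks A B j (ofBlocks A B j X)) =
      -(α : Module.Dual ℝ Heis) X
    rw [hJ.1, map_neg]
  have h := inducesOrientation_neg_iff_pfaff_neg (V := closedForms) formBasis (hat hJ) hsq
  rwa [hat_formBasis, pfaff_transpose] at h

/-- A basis `v, A v, w, A w` of `ℝ⁴`, lifted to the Heisenberg algebra and followed by a vector of the
centre and its image, has a block triangular coordinate matrix. -/
theorem inducesOrientation_ofBlocks_iff (A : Matrix (Fin 4) (Fin 4) ℝ)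
    (B : Matrix (Fin 2) (Fin 4) ℝ) (j : Matrix (Fin 2) (Fin 2) ℝ)
    (hJ : IsComplexStructure (ofBlocks A B j)) :
    InducesOrientation (ofBlocks A B j : Heis →ₗ[ℝ] Heis) stdBasis.orientation ↔
      0 < pfaff A * j 1 0 := by
  obtain ⟨hA, hj, -, -⟩ := (isComplexStructure_ofBlocks A B j).1 hJ
  have hAlin : A.mulVecLin * A.mulVecLin = (-1 : Module.End ℝ (Fin 4 → ℝ)) := by
    rw [Module.End.mul_eq_comp, ← mulVecLin_mul, hA]
    ext; simp
  let e : Fin 2 × Fin 2 ≃ Fin 4 := finProdFinEquiv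
  obtain ⟨f, hf⟩ := exists_adapted (n := 2) A.mulVecLin hAlin (by simp)
  have hpf := det_adapted_mul_pfaff_pos ((Pi.basisFun ℝ (Fin 4)).reindex e.symm) f A.mulVecLin
    hAlin hf
  have hAA : Matrix.reindex finProdFinEquiv finProdFinEquiv
      (LinearMap.toMatrix ((Pi.basisFun ℝ (Fin 4)).reindex e.symm)
        ((Pi.basisFun ℝ (Fin 4)).reindex e.symm) A.mulVecLin) = A := by
    ext i k
    simp [LinearMap.toMatrix_apply, e]
  rw [hAA] at hpf
  have hjdet : j 1 0 ≠ 0 := fun h0 => by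
    have := congrFun (congrFun hj 0) 0
    simp [Matrix.mul_apply, Fin.sum_univ_two, h0] at this
    nlinarith [mul_self_nonneg (j 0 0)]
  let x : Fin 3 → Heis :=
    ![split.symm (f (0, 0), 0), split.symm (f (1, 0), 0), split.symm (0, ![1, 0])]
  let g : Fin 3 × Fin 2 → Heis := fun p => ![x p.1, ofBlocks A B j (x p.1)] p.2
  let e' : Fin 3 × Fin 2 ≃ Fin 4 ⊕ Fin 2 :=
    (show Fin 3 × Fin 2 ≃ Fin (4 + 2) from finProdFinEquiv).trans finSumFinEquiv.symm
  have hdet : stdBasis.det g = ((Pi.basisFun ℝ (Fin 4)).reindex e.symm).det f * j 1 0 := by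
    have hc1 : ∀ (i : Fin 4) z, stdBasis.repr z (e'.symm (Sum.inl i)) = (split z).1 i :=
      fun i z => by fin_cases i <;> rfl
    have hc2 : ∀ (i : Fin 2) z, stdBasis.repr z (e'.symm (Sum.inr i)) = (split z).2 i :=
      fun i z => by fin_cases i <;> rfl
    have hg1 : ∀ k : Fin 4, (split (g (e'.symm (Sum.inl k)))).1 = f (e.symm k) := fun k => by
      fin_cases k
      · exact congrArg Prod.fst (split.apply_symm_apply (f (0, 0), 0))
      · change (split (ofBlocks A B j (split.symm (f (0, 0), 0)))).1 = f (0, 1)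
        rw [split_ofBlocks, LinearEquiv.apply_symm_apply, hf]
        rfl
      · exact congrArg Prod.fst (split.apply_symm_apply (f (1, 0), 0))
      · change (split (ofBlocks A B j (split.symm (f (1, 0), 0)))).1 = f (1, 1)
        rw [split_ofBlocks, LinearEquiv.apply_symm_apply, hf]
        rfl
    have hg2 : split (g (e'.symm (Sum.inr 0))) = (0, ![1, 0]) := split.apply_symm_apply _
    have hg3 : split (g (e'.symm (Sum.inr 1))) = (0, j *ᵥ ![1, 0]) := by
      change split (ofBlocks A B j (split.symm (0, ![1, 0]))) = _
      rw [split_ofBlocks, LinearEquiv.apply_symm_apply]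
      simp
    rw [Module.Basis.det_apply, ← det_reindex_self e', ← fromBlocks_toBlocks (reindex e' e' _)]
    have h12 : (reindex e' e' (stdBasis.toMatrix g)).toBlocks₁₂ = 0 := by
      ext i k
      simp only [toBlocks₁₂, of_apply, reindex_apply, submatrix_apply, Module.Basis.toMatrix_apply,
        hc1]
      fin_cases k
      · simp [hg2]
      · simp [hg3]
    rw [h12, det_fromBlocks_zero₁₂]
    congr 1
    · rw [Module.Basis.det_apply, ← det_reindex_self e]
      congr 1
      ext i k
      simp [toBlocks₁₁, Module.Basis.toMatrix_apply, hc1, hg1]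
    · rw [det_fin_two]
      simp [toBlocks₂₂, Module.Basis.toMatrix_apply, hc2, hg2, hg3]
  have hne : stdBasis.det g ≠ 0 := by
    rw [hdet]
    exact mul_ne_zero (left_ne_zero_of_mul hpf.ne') hjdet
  obtain ⟨hli, hsp⟩ := stdBasis.is_basis_iff_det.2 (isUnit_iff_ne_zero.2 hne)
  let gb := Module.Basis.mk hli hsp.ge
  have hgb : ⇑gb = g := Module.Basis.coe_mk _ _
  have hJ2 : (ofBlocks A B j : Heis →ₗ[ℝ] Heis) * (ofBlocks A B j : Heis →ₗ[ℝ] Heis) =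
      (-1 : Module.End ℝ Heis) := LinearMap.ext hJ.1
  rw [inducesOrientation_iff_det_pos _ hJ2 stdBasis gb (fun k => by rw [hgb]; rfl), hgb, hdet]
  constructor
  · intro h
    have := mul_pos hpf h
    by_contra! hn
    nlinarith [mul_self_nonneg (((Pi.basisFun ℝ (Fin 4)).reindex e.symm).det f)]
  · intro h
    have := mul_pos hpf h
    by_contra! hn
    nlinarith [mul_self_nonneg (pfaff A)]

/-! ### The homeomorphism with the space of triples -/

theorem ofBlocks_mem_CMinus_iff (A : Matrix (Fin 4) (Fin 4) ℝ) (B : Matrix (Fin 2) (Fin 4) ℝ)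
    (j : Matrix (Fin 2) (Fin 2) ℝ) : ofBlocks A B j ∈ CMinus ↔ (A, B, j) ∈ model := by
  constructor
  · rintro ⟨⟨hJ, ho⟩, hJ', hneg⟩
    rw [inducesOrientation_hat_iff] at hneg
    rw [inducesOrientation_ofBlocks_iff A B j hJ] at ho
    obtain ⟨hA, hj, hB, hN⟩ := (isComplexStructure_ofBlocks A B j).1 hJ
    exact ⟨⟨hA, hneg⟩, ⟨hj, neg_of_mul_pos_right ho hneg.le⟩, hB, hN⟩
  · rintro ⟨⟨hA, hneg⟩, ⟨hj, hc⟩, hB, hN⟩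
    have hJ := (isComplexStructure_ofBlocks A B j).2 ⟨hA, hj, hB, hN⟩
    exact ⟨⟨hJ, (inducesOrientation_ofBlocks_iff A B j hJ).2 (mul_pos_of_neg_of_neg hneg hc)⟩, hJ,
      (inducesOrientation_hat_iff A B j hJ).2 hneg⟩

theorem blocks_mem_model {J : Heis →L[ℝ] Heis} (hJ : J ∈ CMinus) : blocks J ∈ model :=
  (ofBlocks_mem_CMinus_iff _ _ _).1 (hJ.1.1.ofBlocks_blocks.symm ▸ hJ)

/-- The homeomorphism that sends a complex structure to its blocks. -/
def homeomorphModel : CMinus ≃ₜ model where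
  toFun J := ⟨blocks J.1, blocks_mem_model J.2⟩
  invFun x := ⟨ofBlocks x.1.1 x.1.2.1 x.1.2.2, (ofBlocks_mem_CMinus_iff _ _ _).2 x.2⟩
  left_inv J := Subtype.ext J.2.1.1.ofBlocks_blocks
  right_inv _ := Subtype.ext (blocks_ofBlocks _ _ _)
  continuous_toFun := (continuous_blocks.comp continuous_subtype_val).subtype_mk _
  continuous_invFun := (continuous_ofBlocks.comp continuous_subtype_val).subtype_mk _

end Iwasawa

end

/-- The space `𝒞₋` has the homotopy type of a 2-sphere. -/
theorem theorem4p5 :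
    Nonempty (ContinuousMap.HomotopyEquiv Iwasawa.CMinus
      (Metric.sphere (0 : EuclideanSpace ℝ (Fin 3)) 1)) :=
  ⟨Iwasawa.homeomorphModel.toHomotopyEquiv.trans Iwasawa.modelHomotopyEquiv⟩
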